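/- **Theorem.** All vector spaces are complex and inner products are linear in the first argument. Let $X,Y$ be separable Hilbert spaces with $X$ continuously and densely embedded in $Y$, and regard $Y$ as a subspace of the space $X^*$ of continuous conjugate-linear functionals on $X$ through $\langle v,w\rangle_X=(v,w)_Y$. Let $\pi/2<\omega_0<\pi$, let $c_0,c_1,\mathcal M_0>0$, and put $\Sigma_{\omega_0}=\{re^{i\gamma}: r>0,\ -\omega_0<\gamma<\omega_0\}$. Let $\mathcal A,\mathcal A^*:X\to Y$ be bounded linear operators, also regarded as operators in $Y$ with domain $X$, such that $\Sigma_{\omega_0}\cup\{0\}\subset\rho(\mathcal A)\cap\rho(\mathcal A^*)$; such that $\|R(z,\mathcal A)\|_{\mathcal L(Y)}$ and $\|R(z,\mathcal A^*)\|_{\mathcal L(Y)}$ are at most $\mathcal M_0/(1+|z|)$ for $z\in\Sigma_{\omega_0}$, where $R(z,B)=(z-B)^{-1}$; such that $(\mathcal Av,w)_Y=(v,\mathcal A^*w)_Y$ for $v,w\in X$; and such that $c_0\|v\|_X\le\|\mathcal Av\|_Y\le c_1\|v\|_X$ and $c_0\|v\|_X\le\|\mathcal A^*v\|_Y\le c_1\|v\|_X$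 for $v\in X$. Extend $\mathcal A$ to an operator $Y\to X^*$ by $\langle\mathcal Av,w\rangle_X=(v,\mathcal A^*w)_Y$. For $0<\alpha\le1$ and $t>0$ put $$E_\alpha(t)=\frac1{2\pi i}\int_{\Gamma}e^{tz}R(z^\alpha,\mathcal A)\,dz\in\mathcal L(X^*,Y),\qquad E_\alpha^*(t)=\frac1{2\pi i}\int_{\Gamma}e^{tz}R(z^\alpha,\mathcal A^*)\,dz\in\mathcal L(Y,X),$$ where $\Gamma$ is the boundary of $\Sigma_{\omega_0}$, oriented with the negative real axis to its left, and $z^\alpha$ is the principal branch. Let $0<T<\infty$ and $$(\mathcal S_\alpha g)(t)=\int_0^tE_\alpha(t-s)g(s)\,ds,\qquad (\mathcal S_\alpha^*(q\delta_T))(t)=E_\alpha^*(T-t)q\quad(q\in Y).$$ Let $0<\theta_0\le1$, let $[X^*,Y]_{\theta_0}$ and $[X,Y]_{\theta_0}$ be the complex interpolation spaces, paired by the continuous extension of $\langle f,v\rangle_X$ from $v\in X$ to $v\in[X,Y]_{\theta_0}$. Let $Z$ be a Hilbert space, $\mathcal R_{\theta_0}:Z\to[X^*,Y]_{\theta_0}$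 a bounded linear operator, and define $\mathcal R_{\theta_0}^*:[X,Y]_{\theta_0}\to Z$ by $(\mathcal R_{\theta_0}^*v,w)_Z=\overline{\langle\mathcal R_{\theta_0}w,v\rangle}$. Let $y_d\in Y$, $\nu>0$, and let $U_{\rm ad}\subset L^\infty(0,T;Z)$ be a non-empty, convex, bounded and closed subset of $L^2(0,T;Z)$. Then, for every $u\in U_{\rm ad}$ and $t\in[0,T]$, the integral defining $(\mathcal S_\alpha\mathcal R_{\theta_0}u)(t)$ converges in $Y$, and the problem $$\min_{u\in U_{\rm ad}}J_\alpha(u),\qquad J_\alpha(u)=\tfrac12\|(\mathcal S_\alpha\mathcal R_{\theta_0}u)(T)-y_d\|_Y^2+\tfrac\nu2\|u\|_{L^2(0,T;Z)}^2,$$ has exactly one solution $u\in U_{\rm ad}$. With $y=\mathcal S_\alpha\mathcal R_{\theta_0}u$ and $p=\mathcal S_\alpha^*\big((y(T)-y_d)\delta_T\big)$ it satisfies $$\operatorname{Re}\int_0^T\big(\mathcal R_{\theta_0}^*p(t)+\nu u(t),\,v(t)-u(t)\big)_Z\,dt\ge0\qquad\text{for all }v\in U_{\rm ad},$$ the integrand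 being integrable on $(0,T)$. -/

import Mathlib

open Complex Set Filter Topology MeasureTheory
open scoped BoundedContinuousFunction InnerProductSpace ComplexConjugate

noncomputable section

namespace FracControl

/-! ### Complex interpolation -/

section Interpolation

variable {E₀ E₁ V : Type*}
  [NormedAddCommGroup E₀] [NormedSpace ℂ E₀]
  [NormedAddCommGroup E₁] [NormedSpace ℂ E₁]
  [NormedAddCommGroup V] [NormedSpace ℂ V]

/-- Let `E₀` and `E₁` be continuously embedded (by `i₀`, `i₁`) in `V = E₀ + E₁`; below, one of the
two embeddings is always the identity of the larger space.  A function `f` on the closed strip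
`0 ≤ Re z ≤ 1` is admissible, with boundary values `g₀` and `g₁`, if it is holomorphic in the
interior, continuous and bounded up to the boundary with values in `E₀ + E₁`, and if
`t ↦ f (it)` and `t ↦ f (1 + it)` are bounded continuous functions with values in `E₀`, resp. in
`E₁`. -/
structure IsAdmissible (i₀ : E₀ →L[ℂ] V) (i₁ : E₁ →L[ℂ] V) (f : ℂ → V)
    (g₀ : ℝ →ᵇ E₀) (g₁ : ℝ →ᵇ E₁) : Prop where
  holo : DiffContOnCl ℂ f (Complex.HadamardThreeLines.verticalStrip 0 1)
  bdd : ∃ C : ℝ, ∀ z ∈ Complex.HadamardThreeLines.verticalClosedStrip 0 1, ‖f z‖ ≤ C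
  left : ∀ t : ℝ, f ((t : ℂ) * I) = i₀ (g₀ t)
  right : ∀ t : ℝ, f (1 + (t : ℂ) * I) = i₁ (g₁ t)

namespace IsAdmissible

variable {i₀ : E₀ →L[ℂ] V} {i₁ : E₁ →L[ℂ] V} {f f' : ℂ → V}
  {g₀ g₀' : ℝ →ᵇ E₀} {g₁ g₁' : ℝ →ᵇ E₁}

theorem zero : IsAdmissible i₀ i₁ 0 0 0 where
  holo := diffContOnCl_const (c := (0 : V))
  bdd := ⟨0, fun z _ => by simp⟩
  left := fun t => by simp
  right := fun t => by simp

theorem add (h : IsAdmissible i₀ i₁ f g₀ g₁) (h' : IsAdmissible i₀ i₁ f' g₀' g₁') :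
    IsAdmissible i₀ i₁ (f + f') (g₀ + g₀') (g₁ + g₁') where
  holo := h.holo.add h'.holo
  bdd := by
    obtain ⟨C, hC⟩ := h.bdd
    obtain ⟨C', hC'⟩ := h'.bdd
    exact ⟨C + C', fun z hz => (norm_add_le _ _).trans (add_le_add (hC z hz) (hC' z hz))⟩
  left := fun t => by simp [h.left t, h'.left t]
  right := fun t => by simp [h.right t, h'.right t]

theorem smul (c : ℂ) (h : IsAdmissible i₀ i₁ f g₀ g₁) :
    IsAdmissible i₀ i₁ (c • f) (c • g₀) (c • g₁) where
  holo := h.holo.const_smul c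
  bdd := by
    obtain ⟨C, hC⟩ := h.bdd
    refine ⟨‖c‖ * C, fun z hz => ?_⟩
    rw [Pi.smul_apply, norm_smul]
    exact mul_le_mul_of_nonneg_left (hC z hz) (norm_nonneg c)
  left := fun t => by simp [h.left t]
  right := fun t => by simp [h.right t]

end IsAdmissible

/-- The vector space underlying `[E₀, E₁]_θ`: the values at `θ` of the admissible functions. -/
def interpSubmodule (i₀ : E₀ →L[ℂ] V) (i₁ : E₁ →L[ℂ] V) (θ : unitInterval) : Submodule ℂ V where
  carrier := {a | ∃ f g₀ g₁, IsAdmissible i₀ i₁ f g₀ g₁ ∧ f ((θ : ℝ) : ℂ) = a}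
  zero_mem' := ⟨0, 0, 0, IsAdmissible.zero, rfl⟩
  add_mem' := by
    rintro _ _ ⟨f, g₀, g₁, h, rfl⟩ ⟨f', g₀', g₁', h', rfl⟩
    exact ⟨_, _, _, h.add h', rfl⟩
  smul_mem' := by
    rintro c _ ⟨f, g₀, g₁, h, rfl⟩
    exact ⟨_, _, _, h.smul c, rfl⟩

/-- The complex interpolation space `[E₀, E₁]_θ`, `0 ≤ θ ≤ 1`. -/
def Interp (i₀ : E₀ →L[ℂ] V) (i₁ : E₁ →L[ℂ] V) (θ : unitInterval) : Type _ :=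
  interpSubmodule i₀ i₁ θ

namespace Interp

variable {i₀ : E₀ →L[ℂ] V} {i₁ : E₁ →L[ℂ] V} {θ : unitInterval}

instance : AddCommGroup (Interp i₀ i₁ θ) :=
  inferInstanceAs (AddCommGroup (interpSubmodule i₀ i₁ θ))

instance : Module ℂ (Interp i₀ i₁ θ) :=
  inferInstanceAs (Module ℂ (interpSubmodule i₀ i₁ θ))

/-- The inclusion `[E₀, E₁]_θ ⊂ E₀ + E₁`. -/
def val : Interp i₀ i₁ θ →ₗ[ℂ] V := (interpSubmodule i₀ i₁ θ).subtype

theorem val_injective : Function.Injective (val (i₀ := i₀) (i₁ := i₁) (θ := θ)) :=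
  Subtype.val_injective

/-- The norms `max (sup ‖f (it)‖_{E₀}) (sup ‖f (1 + it)‖_{E₁})` of the admissible functions `f` with
`f θ = a`. -/
def normSet (a : Interp i₀ i₁ θ) : Set ℝ :=
  {r | ∃ f g₀ g₁, IsAdmissible i₀ i₁ f g₀ g₁ ∧ f ((θ : ℝ) : ℂ) = val a ∧ r = max ‖g₀‖ ‖g₁‖}

/-- The norm of `[E₀, E₁]_θ`: the infimum of the norms of the admissible functions `f` with
`f θ = a`. -/
instance : Norm (Interp i₀ i₁ θ) := ⟨fun a => sInf (normSet a)⟩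

theorem norm_def (a : Interp i₀ i₁ θ) : ‖a‖ = sInf (normSet a) := rfl

theorem normSet_nonempty (a : Interp i₀ i₁ θ) : (normSet a).Nonempty := by
  obtain ⟨a, f, g₀, g₁, h, ha⟩ := a
  exact ⟨_, f, g₀, g₁, h, ha, rfl⟩

theorem nonneg_of_mem_normSet {a : Interp i₀ i₁ θ} {r : ℝ} (hr : r ∈ normSet a) : 0 ≤ r := by
  obtain ⟨f, g₀, g₁, -, -, rfl⟩ := hr
  exact le_max_of_le_left (norm_nonneg _)

theorem bddBelow_normSet (a : Interp i₀ i₁ θ) : BddBelow (normSet a) :=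
  ⟨0, fun _ hr => nonneg_of_mem_normSet hr⟩

theorem norm_le_of_mem {a : Interp i₀ i₁ θ} {r : ℝ} (hr : r ∈ normSet a) : ‖a‖ ≤ r :=
  csInf_le (bddBelow_normSet a) hr

theorem exists_mem_lt {a : Interp i₀ i₁ θ} {s : ℝ} (hs : ‖a‖ < s) : ∃ r ∈ normSet a, r < s :=
  exists_lt_of_csInf_lt (normSet_nonempty a) hs

theorem norm_nonneg' (a : Interp i₀ i₁ θ) : 0 ≤ ‖a‖ :=
  Real.sInf_nonneg fun _ hr => nonneg_of_mem_normSet hr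

/-- The maximum principle on the strip. -/
theorem norm_le_of_strip {G : Type*} [NormedAddCommGroup G] [NormedSpace ℂ G] {f : ℂ → G} {K : ℝ}
    (hd : DiffContOnCl ℂ f (Complex.HadamardThreeLines.verticalStrip 0 1))
    (hb : ∃ C : ℝ, ∀ z ∈ Complex.HadamardThreeLines.verticalClosedStrip 0 1, ‖f z‖ ≤ C)
    (h0 : ∀ t : ℝ, ‖f ((t : ℂ) * I)‖ ≤ K) (h1 : ∀ t : ℝ, ‖f (1 + (t : ℂ) * I)‖ ≤ K)
    (θ : unitInterval) : ‖f ((θ : ℝ) : ℂ)‖ ≤ K := by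
  have hK : 0 ≤ K := (norm_nonneg _).trans (h0 0)
  obtain ⟨C, hC⟩ := hb
  have key := Complex.HadamardThreeLines.norm_le_interp_of_mem_verticalClosedStrip₀₁' f
    (z := ((θ : ℝ) : ℂ)) (a := K) (b := K)
    (by simp [Complex.HadamardThreeLines.verticalClosedStrip]) hd
    ⟨C, by rintro _ ⟨z, hz, rfl⟩; exact hC z hz⟩
    (fun z hz => by
      have hz : z.re = 0 := hz
      have : z = (z.im : ℂ) * I := by apply Complex.ext <;> simp [hz]
      rw [this]; exact h0 _)
    (fun z hz => by
      have hz : z.re = 1 := hz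
      have : z = 1 + (z.im : ℂ) * I := by apply Complex.ext <;> simp [hz]
      rw [this]; exact h1 _)
  refine key.trans (le_of_eq ?_)
  rcases hK.eq_or_lt with rfl | hK
  · by_cases h : (θ : ℝ) = 0
    · simp [h]
    · simp [Real.zero_rpow h]
  · rw [← Real.rpow_add hK]; simp

theorem norm_val_le (a : Interp i₀ i₁ θ) : ‖val a‖ ≤ max ‖i₀‖ ‖i₁‖ * ‖a‖ := by
  have hM : 0 ≤ max ‖i₀‖ ‖i₁‖ := le_max_of_le_left (norm_nonneg _)
  have key : ∀ r ∈ normSet a, ‖val a‖ ≤ max ‖i₀‖ ‖i₁‖ * r := by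
    rintro _ ⟨f, g₀, g₁, h, ha, rfl⟩
    rw [← ha]
    refine norm_le_of_strip h.holo h.bdd (fun t => ?_) (fun t => ?_) θ
    · rw [h.left]
      exact (i₀.le_opNorm _).trans (mul_le_mul (le_max_left _ _)
        ((g₀.norm_coe_le_norm t).trans (le_max_left _ _)) (norm_nonneg _) hM)
    · rw [h.right]
      exact (i₁.le_opNorm _).trans (mul_le_mul (le_max_right _ _)
        ((g₁.norm_coe_le_norm t).trans (le_max_right _ _)) (norm_nonneg _) hM)
  refine le_of_forall_pos_le_add fun ε hε => ?_
  have hδ : 0 < ε / (max ‖i₀‖ ‖i₁‖ + 1) := by positivity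
  obtain ⟨r, hr, hlt⟩ := exists_mem_lt (lt_add_of_pos_right ‖a‖ hδ)
  calc ‖val a‖ ≤ max ‖i₀‖ ‖i₁‖ * r := key r hr
    _ ≤ max ‖i₀‖ ‖i₁‖ * (‖a‖ + ε / (max ‖i₀‖ ‖i₁‖ + 1)) := by gcongr
    _ = max ‖i₀‖ ‖i₁‖ * ‖a‖ + ε * (max ‖i₀‖ ‖i₁‖ / (max ‖i₀‖ ‖i₁‖ + 1)) := by ring
    _ ≤ max ‖i₀‖ ‖i₁‖ * ‖a‖ + ε * 1 := by
        gcongr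
        rw [div_le_one (by positivity)]
        linarith
    _ = _ := by ring

theorem norm_smul_le' (c : ℂ) (a : Interp i₀ i₁ θ) : ‖c • a‖ ≤ ‖c‖ * ‖a‖ := by
  refine le_of_forall_pos_le_add fun ε hε => ?_
  have hδ : 0 < ε / (‖c‖ + 1) := by positivity
  obtain ⟨r, ⟨f, g₀, g₁, h, ha, rfl⟩, hlt⟩ := exists_mem_lt (lt_add_of_pos_right ‖a‖ hδ)
  have hmem : max ‖c • g₀‖ ‖c • g₁‖ ∈ normSet (c • a) :=
    ⟨_, _, _, h.smul c, by simp [ha], rfl⟩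
  calc ‖c • a‖ ≤ max ‖c • g₀‖ ‖c • g₁‖ := norm_le_of_mem hmem
    _ = ‖c‖ * max ‖g₀‖ ‖g₁‖ := by
        rw [norm_smul, norm_smul, mul_max_of_nonneg _ _ (norm_nonneg c)]
    _ ≤ ‖c‖ * (‖a‖ + ε / (‖c‖ + 1)) := by gcongr
    _ = ‖c‖ * ‖a‖ + ε * (‖c‖ / (‖c‖ + 1)) := by ring
    _ ≤ ‖c‖ * ‖a‖ + ε * 1 := by
        gcongr
        rw [div_le_one (by positivity)]
        linarith
    _ = _ := by ring

theorem norm_add_le' (a b : Interp i₀ i₁ θ) : ‖a + b‖ ≤ ‖a‖ + ‖b‖ := by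
  refine le_of_forall_pos_le_add fun ε hε => ?_
  obtain ⟨r, ⟨f, g₀, g₁, h, ha, rfl⟩, hlt⟩ := exists_mem_lt (lt_add_of_pos_right ‖a‖ (half_pos hε))
  obtain ⟨r', ⟨f', g₀', g₁', h', hb, rfl⟩, hlt'⟩ :=
    exists_mem_lt (lt_add_of_pos_right ‖b‖ (half_pos hε))
  have hmem : max ‖g₀ + g₀'‖ ‖g₁ + g₁'‖ ∈ normSet (a + b) :=
    ⟨_, _, _, h.add h', by simp [ha, hb], rfl⟩
  have h3 : max ‖g₀ + g₀'‖ ‖g₁ + g₁'‖ ≤ max ‖g₀‖ ‖g₁‖ + max ‖g₀'‖ ‖g₁'‖ :=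
    max_le ((norm_add_le _ _).trans (add_le_add (le_max_left _ _) (le_max_left _ _)))
      ((norm_add_le _ _).trans (add_le_add (le_max_right _ _) (le_max_right _ _)))
  have := norm_le_of_mem hmem
  linarith

theorem normCore : NormedSpace.Core ℂ (Interp i₀ i₁ θ) where
  norm_nonneg := norm_nonneg'
  norm_smul := fun c a => by
    refine le_antisymm (norm_smul_le' c a) ?_
    by_cases hc : c = 0
    · subst hc
      rw [norm_zero, zero_mul]
      exact norm_nonneg' _
    · have := norm_smul_le' c⁻¹ (c • a)
      rw [inv_smul_smul₀ hc, norm_inv] at this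
      rwa [inv_mul_eq_div, le_div_iff₀' (norm_pos_iff.2 hc)] at this
  norm_triangle := norm_add_le'
  norm_eq_zero_iff := fun a => by
    constructor
    · intro h
      have := norm_val_le a
      rw [h, mul_zero, norm_le_zero_iff] at this
      exact val_injective (by simpa using this)
    · rintro rfl
      refine le_antisymm (norm_le_of_mem ⟨0, 0, 0, IsAdmissible.zero, by simp, by simp⟩)
        (norm_nonneg' _)

instance : NormedAddCommGroup (Interp i₀ i₁ θ) := NormedAddCommGroup.ofCore normCore

instance : NormedSpace ℂ (Interp i₀ i₁ θ) := NormedSpace.ofCore normCore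

end Interp

end Interpolation

/-! ### The Gelfand triple, the operators, and their resolvents -/

/-- The space `X^*`.  It consists of the conjugate-linear continuous functionals, and `⟨f, x⟩_X` is
`f x`, so that the pairing, like the inner product it extends, is linear in the first and
conjugate-linear in the second argument. -/
abbrev AntiDual (X : Type*) [NormedAddCommGroup X] [NormedSpace ℂ X] : Type _ := X →L⋆[ℂ] ℂ

section Triple

variable {X Y : Type*} [NormedAddCommGroup X] [InnerProductSpace ℂ X]
  [NormedAddCommGroup Y] [InnerProductSpace ℂ Y]

/-- For a bounded operator `B : X → Y`, the operator `Y → X^*` given by `⟨v ↦ (v, B x)_Y⟩`. -/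
def transpose (B : X →L[ℂ] Y) : Y →L[ℂ] AntiDual X :=
  (ContinuousLinearMap.compSL X Y ℂ (RingHom.id ℂ) (starRingEnd ℂ)).flip B ∘L innerSLFlip ℂ

/-- `⟨transpose B v, x⟩_X = (v, B x)_Y`; Mathlib's inner product is linear in the second argument. -/
theorem transpose_apply (B : X →L[ℂ] Y) (v : Y) (x : X) : transpose B v x = ⟪B x, v⟫_ℂ := rfl

/-- `[X^*, Y]_θ`, where `Y ⊂ X^*` through `⟨v, x⟩_X = (v, x)_Y`. -/
abbrev InterpNeg (ι : X →L[ℂ] Y) (θ : unitInterval) : Type _ :=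
  Interp (ContinuousLinearMap.id ℂ (AntiDual X)) (transpose ι) θ

/-- `[X, Y]_θ`, where `X ⊂ Y` through `ι`. -/
abbrev InterpPos (ι : X →L[ℂ] Y) (θ : unitInterval) : Type _ :=
  Interp ι (ContinuousLinearMap.id ℂ Y) θ

/-- The inclusion of `X` in `[X, Y]_θ`. -/
def inclPos (ι : X →L[ℂ] Y) (θ : unitInterval) : X →L[ℂ] InterpPos ι θ :=
  LinearMap.mkContinuous
    { toFun := fun x => (⟨ι x, fun _ => ι x, BoundedContinuousFunction.const ℝ x,
        BoundedContinuousFunction.const ℝ (ι x),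
        ⟨diffContOnCl_const, ⟨‖ι x‖, fun _ _ => le_rfl⟩, fun _ => rfl, fun _ => rfl⟩, rfl⟩ :
          interpSubmodule ι (ContinuousLinearMap.id ℂ Y) θ)
      map_add' := fun x x' => Subtype.ext (map_add ι x x')
      map_smul' := fun c x => Subtype.ext (map_smul ι c x) }
    (max 1 ‖ι‖)
    (fun x => by
      refine (Interp.norm_le_of_mem ⟨fun _ => ι x, BoundedContinuousFunction.const ℝ x,
        BoundedContinuousFunction.const ℝ (ι x),
        ⟨diffContOnCl_const, ⟨‖ι x‖, fun _ _ => le_rfl⟩, fun _ => rfl, fun _ => rfl⟩,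
        rfl, rfl⟩).trans ?_
      refine max_le ?_ ?_
      · refine (BoundedContinuousFunction.norm_const_le x).trans ?_
        exact le_mul_of_one_le_left (norm_nonneg x) (le_max_left _ _)
      · refine (BoundedContinuousFunction.norm_const_le (ι x)).trans ((ι.le_opNorm x).trans ?_)
        exact mul_le_mul_of_nonneg_right (le_max_right _ _) (norm_nonneg x))

theorem val_inclPos (ι : X →L[ℂ] Y) (θ : unitInterval) (x : X) :
    Interp.val (inclPos ι θ x) = ι x := rfl

/-- The duality pairing of `[X^*, Y]_θ` and `[X, Y]_θ`: the extension by continuity, from `X` to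
`[X, Y]_θ`, of the functional `x ↦ ⟨f, x⟩_X`, for `f` in `[X^*, Y]_θ ⊂ X^*`. -/
def dualPairing {ι : X →L[ℂ] Y} {θ : unitInterval} (f : InterpNeg ι θ) (v : InterpPos ι θ) : ℂ :=
  limUnder (comap (inclPos ι θ) (𝓝 v)) (fun x : X => Interp.val f x)


/-! That this extension exists at the points of `X`. -/

section Duality

variable [CompleteSpace X] [CompleteSpace Y]

/-- Regularizing operators `Y → X`, contractive on `Y` and on `X`. -/
theorem exists_regularizer (ι : X →L[ℂ] Y) {ε : ℝ} (hε : 0 < ε) :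
    ∃ P : Y →L[ℂ] X, (∀ y, ‖ι (P y)‖ ≤ ‖y‖) ∧ (∀ x, ‖P (ι x)‖ ≤ ‖x‖) ∧
      ∀ x, ‖ι (x - P (ι x))‖ ^ 2 ≤ 2 * ε * ‖x‖ ^ 2 := by
  set S : Y →L[ℂ] X := ContinuousLinearMap.adjoint ι with hS
  set B : X →L[ℂ] X := S ∘L ι + (ε : ℂ) • ContinuousLinearMap.id ℂ X with hB
  have hBapp : ∀ x, B x = S (ι x) + (ε : ℂ) • x := fun x => rfl
  have hre : ∀ x, (⟪B x, x⟫_ℂ) = ((‖ι x‖ ^ 2 + ε * ‖x‖ ^ 2 : ℝ) : ℂ) := by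
    intro x
    rw [hBapp, inner_add_left, hS, ContinuousLinearMap.adjoint_inner_left, inner_smul_left,
      inner_self_eq_norm_sq_to_K, inner_self_eq_norm_sq_to_K]
    simp
  have hunit : IsUnit B := by
    refine ContinuousLinearMap.isUnit_of_forall_le_norm_inner_map B (c := ⟨ε, hε.le⟩) hε
      (fun x => ?_)
    rw [hre, Complex.norm_real, Real.norm_of_nonneg (by positivity)]
    change ‖x‖ ^ 2 * ε ≤ _
    nlinarith [sq_nonneg ‖ι x‖]
  obtain ⟨U, hU⟩ := hunit
  have hBU : ∀ x, B ((↑U⁻¹ : X →L[ℂ] X) x) = x := by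
    intro x
    have : (B * (↑U⁻¹ : X →L[ℂ] X)) x = x := by rw [← hU, Units.mul_inv]; rfl
    exact this
  refine ⟨(↑U⁻¹ : X →L[ℂ] X) ∘L S, fun y => ?_, fun x => ?_, fun x => ?_⟩
  · set u : X := (↑U⁻¹ : X →L[ℂ] X) (S y) with hu
    change ‖ι u‖ ≤ ‖y‖
    have h1 : S (ι u) + (ε : ℂ) • u = S y := by rw [← hBapp, hu, hBU]
    have h2 : ⟪S y, u⟫_ℂ = ⟪y, ι u⟫_ℂ := by rw [hS, ContinuousLinearMap.adjoint_inner_left]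
    have h3 := hre u
    rw [hBapp, h1, h2] at h3
    have h4 : ‖ι u‖ ^ 2 + ε * ‖u‖ ^ 2 ≤ ‖y‖ * ‖ι u‖ := by
      have := norm_inner_le_norm (𝕜 := ℂ) y (ι u)
      rwa [h3, Complex.norm_real, Real.norm_of_nonneg (by positivity)] at this
    by_contra! hlt
    nlinarith [norm_nonneg y, norm_nonneg (ι u), mul_nonneg hε.le (sq_nonneg ‖u‖)]
  all_goals
    set u : X := (↑U⁻¹ : X →L[ℂ] X) (S (ι x)) with hu
    have h1 : S (ι (x - u)) = (ε : ℂ) • u := by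
      have : S (ι u) + (ε : ℂ) • u = S (ι x) := by rw [← hBapp, hu, hBU]
      rw [map_sub, map_sub, ← this]; abel
    have h2 : ⟪(ε : ℂ) • u, x - u⟫_ℂ = ((‖ι (x - u)‖ ^ 2 : ℝ) : ℂ) := by
      rw [← h1, hS, ContinuousLinearMap.adjoint_inner_left, inner_self_eq_norm_sq_to_K]
      simp
    have h3 : ε * (⟪u, x - u⟫_ℂ).re = ‖ι (x - u)‖ ^ 2 := by
      have := congrArg Complex.re h2
      rw [inner_smul_left] at this
      simpa only [Complex.conj_ofReal, Complex.re_ofReal_mul, Complex.ofReal_re] using this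
    have h4 : (⟪u, x - u⟫_ℂ).re = (⟪u, x⟫_ℂ).re - ‖u‖ ^ 2 := by
      rw [inner_sub_right, Complex.sub_re]
      congr 1
      exact inner_self_eq_norm_sq (𝕜 := ℂ) u
    have h5 : (⟪u, x⟫_ℂ).re ≤ ‖u‖ * ‖x‖ :=
      (Complex.re_le_norm _).trans (norm_inner_le_norm u x)
    have h6 : 0 ≤ (⟪u, x - u⟫_ℂ).re := by
      have : 0 ≤ ε * (⟪u, x - u⟫_ℂ).re := by rw [h3]; positivity
      exact nonneg_of_mul_nonneg_right this hε
    have h7 : ‖u‖ ≤ ‖x‖ := by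
      by_contra! hlt
      nlinarith [norm_nonneg x, norm_nonneg u]
  · exact h7
  · change ‖ι (x - u)‖ ^ 2 ≤ _
    rw [← h3]
    have h8 : (⟪u, x - u⟫_ℂ).re ≤ 2 * ‖x‖ ^ 2 := by
      nlinarith [norm_nonneg x, norm_nonneg u, sq_nonneg ‖u‖]
    nlinarith

/-- `Y` is dense in `X^*`. -/
theorem exists_transpose_near {ι : X →L[ℂ] Y} (hι : Function.Injective ι) (f : AntiDual X)
    {δ : ℝ} (hδ : 0 < δ) : ∃ b : Y, ∀ x, ‖f x - ⟪ι x, b⟫_ℂ‖ ≤ δ * ‖x‖ := by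
  have hrep : ∃ a : X, ∀ x, f x = ⟪x, a⟫_ℂ := by
    let g : X →L[ℂ] ℂ := (starL ℂ : ℂ ≃L⋆[ℂ] ℂ).toContinuousLinearMap.comp f
    refine ⟨(InnerProductSpace.toDual ℂ X).symm g, fun x => ?_⟩
    rw [← inner_conj_symm, InnerProductSpace.toDual_symm_apply]
    change f x = conj (conj (f x))
    simp
  obtain ⟨a, ha⟩ := hrep
  have hdense : (ContinuousLinearMap.adjoint ι).range.topologicalClosure = ⊤ := by
    rw [Submodule.topologicalClosure_eq_top_iff, ContinuousLinearMap.orthogonal_range,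
      ContinuousLinearMap.adjoint_adjoint]
    exact LinearMap.ker_eq_bot.2 hι
  have hmem : a ∈ closure ((ContinuousLinearMap.adjoint ι).range : Set X) := by
    rw [← Submodule.topologicalClosure_coe, hdense]; trivial
  obtain ⟨_, ⟨b, rfl⟩, hb⟩ := Metric.mem_closure_iff.1 hmem δ hδ
  refine ⟨b, fun x => ?_⟩
  rw [ha, ← ContinuousLinearMap.adjoint_inner_right ι x b, ← inner_sub_right, mul_comm]
  refine (norm_inner_le_norm _ _).trans (mul_le_mul_of_nonneg_left ?_ (norm_nonneg x))
  rw [← dist_eq_norm]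
  exact hb.le

/-- Evaluation at the points of `X`, as a conjugate-linear operator `X → X^{**}`. -/
def evalAt : X →L⋆[ℂ] (AntiDual X →L[ℂ] ℂ) := (ContinuousLinearMap.id ℂ (AntiDual X)).flip

theorem differentiableAt_conj {E G : Type*} [NormedAddCommGroup E] [NormedSpace ℂ E]
    [NormedAddCommGroup G] [NormedSpace ℂ G] (Φ : E →L⋆[ℂ] G) {k : ℂ → E} {z : ℂ}
    (hk : DifferentiableAt ℂ k (conj z)) : DifferentiableAt ℂ (fun w => Φ (k (conj w))) z := by
  have h := hk.hasDerivAt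
  rw [hasDerivAt_iff_tendsto_slope] at h
  refine HasDerivAt.differentiableAt (f' := Φ (deriv k (conj z))) ?_
  rw [hasDerivAt_iff_tendsto_slope]
  have hc : Tendsto (fun w : ℂ => conj w) (𝓝[≠] z) (𝓝[≠] (conj z)) := by
    refine tendsto_nhdsWithin_iff.2
      ⟨(Complex.continuous_conj.tendsto z).mono_left nhdsWithin_le_nhds, ?_⟩
    filter_upwards [self_mem_nhdsWithin] with w hw
    exact fun h => hw ((starRingEnd ℂ).injective h)
  refine ((Φ.continuous.tendsto _).comp (h.comp hc)).congr fun w => ?_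
  simp [slope_def_module, ← map_sub, ContinuousLinearMap.map_smulₛₗ]

/-- The pairing of `f ∈ [X^*, Y]_θ` and `x ∈ X` is bounded by `‖f‖ ‖x‖_{[X, Y]_θ}`. -/
theorem norm_val_apply_le {ι : X →L[ℂ] Y} (hι : Function.Injective ι) {θ : unitInterval}
    (f : InterpNeg ι θ) (x : X) : ‖Interp.val f x‖ ≤ ‖f‖ * ‖inclPos ι θ x‖ := by
  have key : ∀ r ∈ Interp.normSet f, ∀ s ∈ Interp.normSet (inclPos ι θ x),
      ‖Interp.val f x‖ ≤ r * s := by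
    rintro r ⟨F, g₀, g₁, hF, hFf, rfl⟩ s ⟨G, h₀, h₁, hG, hGx, rfl⟩
    rw [val_inclPos] at hGx
    have hR : (0:ℝ) ≤ max ‖g₀‖ ‖g₁‖ := le_max_of_le_left (norm_nonneg _)
    have hP : ∀ P : Y →L[ℂ] X, (∀ y, ‖ι (P y)‖ ≤ ‖y‖) → (∀ x, ‖P (ι x)‖ ≤ ‖x‖) →
        ‖Interp.val f (P (ι x))‖ ≤ max ‖g₀‖ ‖g₁‖ * max ‖h₀‖ ‖h₁‖ := by
      intro P hPY hPX
      have hclos : ∀ z : ℂ, z ∈ closure (Complex.HadamardThreeLines.verticalStrip 0 1) →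
          conj z ∈ closure (Complex.HadamardThreeLines.verticalStrip 0 1) := by
        intro z hz
        refine map_mem_closure Complex.continuous_conj hz fun w hw => ?_
        simpa [Complex.HadamardThreeLines.verticalStrip] using hw
      have hopen : IsOpen (Complex.HadamardThreeLines.verticalStrip 0 1) :=
        isOpen_Ioo.preimage Complex.continuous_re
      have main := Interp.norm_le_of_strip (f := fun z => F z (P (G (conj z))))
        (K := max ‖g₀‖ ‖g₁‖ * max ‖h₀‖ ‖h₁‖) ?_ ?_ ?_ ?_ θ
      · simpa [hGx, hFf] using main
      · have hk : DiffContOnCl ℂ (fun z => evalAt (P (G (conj z))))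
            (Complex.HadamardThreeLines.verticalStrip 0 1) := by
          constructor
          · intro z hz
            refine (differentiableAt_conj (G := AntiDual X →L[ℂ] ℂ) evalAt (k := fun w => P (G w)) ?_).differentiableWithinAt
            refine P.differentiableAt.comp _ (hG.holo.differentiableOn.differentiableAt ?_)
            refine hopen.mem_nhds ?_
            simpa [Complex.HadamardThreeLines.verticalStrip] using hz
          · refine (evalAt (X := X)).continuous.comp_continuousOn
              (P.continuous.comp_continuousOn ?_)
            exact hG.holo.continuousOn.comp Complex.continuous_conj.continuousOn hclos
        exact ⟨hk.differentiableOn.clm_apply hF.holo.differentiableOn,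
          hk.continuousOn.clm_apply hF.holo.continuousOn⟩
      · obtain ⟨C, hC⟩ := hF.bdd
        obtain ⟨D, hD⟩ := hG.bdd
        refine ⟨C * (‖P‖ * D), fun z hz => ?_⟩
        have hz' : conj z ∈ Complex.HadamardThreeLines.verticalClosedStrip 0 1 := by
          simpa [Complex.HadamardThreeLines.verticalClosedStrip] using hz
        refine ((F z).le_opNorm _).trans ?_
        refine mul_le_mul (hC z hz) ((P.le_opNorm _).trans ?_) (norm_nonneg _)
          ((norm_nonneg _).trans (hC z hz))
        exact mul_le_mul_of_nonneg_left (hD _ hz') (norm_nonneg _)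
      · intro t
        have hc : conj ((t : ℂ) * I) = ((-t : ℝ) : ℂ) * I := by simp
        simp only [hc, hF.left, hG.left]
        refine (ContinuousLinearMap.le_opNorm _ _).trans ?_
        refine mul_le_mul ((g₀.norm_coe_le_norm t).trans (le_max_left _ _)) ?_ (norm_nonneg _) hR
        exact (hPX _).trans ((h₀.norm_coe_le_norm _).trans (le_max_left _ _))
      · intro t
        have hc : conj (1 + (t : ℂ) * I) = 1 + ((-t : ℝ) : ℂ) * I := by simp
        simp only [hc, hF.right, hG.right, transpose_apply]
        refine (norm_inner_le_norm _ _).trans ?_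
        rw [mul_comm]
        refine mul_le_mul ((g₁.norm_coe_le_norm t).trans (le_max_right _ _)) ?_ (norm_nonneg _) hR
        exact (hPY _).trans ((h₁.norm_coe_le_norm _).trans (le_max_right _ _))
    refine le_of_forall_pos_le_add fun η hη => ?_
    set δ : ℝ := η / (4 * (‖x‖ + 1)) with hδ
    have hδ0 : 0 < δ := by positivity
    obtain ⟨b, hb⟩ := exists_transpose_near hι (Interp.val f) hδ0
    set ρ : ℝ := η / (2 * (‖b‖ + 1)) with hρ
    have hρ0 : 0 < ρ := by positivity
    obtain ⟨P, hPY, hPX, hPε⟩ := exists_regularizer ι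
      (ε := ρ ^ 2 / (2 * (‖x‖ ^ 2 + 1))) (by positivity)
    have hw : ‖ι (x - P (ι x))‖ ≤ ρ := by
      refine le_of_sq_le_sq ((hPε x).trans ?_) hρ0.le
      have : 2 * (ρ ^ 2 / (2 * (‖x‖ ^ 2 + 1))) * ‖x‖ ^ 2
          = ρ ^ 2 * (‖x‖ ^ 2 / (‖x‖ ^ 2 + 1)) := by field_simp
      rw [this]
      refine mul_le_of_le_one_right (by positivity) ?_
      rw [div_le_one (by positivity)]
      linarith
    have hx2 : ‖x - P (ι x)‖ ≤ 2 * ‖x‖ := by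
      have := norm_sub_le x (P (ι x))
      have := hPX x
      linarith
    have e1 : Interp.val f x = Interp.val f (P (ι x)) +
        (Interp.val f (x - P (ι x)) - ⟪ι (x - P (ι x)), b⟫_ℂ) + ⟪ι (x - P (ι x)), b⟫_ℂ := by
      rw [map_sub (Interp.val f)]; ring
    have e2 : δ * ‖x - P (ι x)‖ ≤ η / 2 := by
      calc δ * ‖x - P (ι x)‖ ≤ δ * (2 * (‖x‖ + 1)) := by gcongr; linarith
        _ = η / 2 := by rw [hδ]; field_simp; norm_num
    have e3 : ‖⟪ι (x - P (ι x)), b⟫_ℂ‖ ≤ η / 2 := by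
      refine (norm_inner_le_norm _ _).trans ?_
      calc ‖ι (x - P (ι x))‖ * ‖b‖ ≤ ρ * (‖b‖ + 1) := by gcongr; linarith
        _ = η / 2 := by rw [hρ]; field_simp
    rw [e1]
    refine (norm_add₃_le).trans ?_
    have := hP P hPY hPX
    have := hb (x - P (ι x))
    linarith
  have inf_mul : ∀ (A : Set ℝ) (c t : ℝ), A.Nonempty → 0 ≤ t → (∀ r ∈ A, c ≤ r * t) →
      c ≤ sInf A * t := by
    intro A c t hA ht h
    rcases ht.eq_or_lt with rfl | ht
    · obtain ⟨r, hr⟩ := hA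
      simpa using h r hr
    · rw [← div_le_iff₀ ht]
      exact le_csInf hA fun r hr => (div_le_iff₀ ht).2 (h r hr)
  refine inf_mul _ _ _ (Interp.normSet_nonempty f) (Interp.norm_nonneg' _) fun r hr => ?_
  rw [mul_comm]
  refine inf_mul _ _ _ (Interp.normSet_nonempty _) (Interp.nonneg_of_mem_normSet hr)
    fun s hs => ?_
  rw [mul_comm]
  exact key r hr s hs

/-- The pairing extends `⟨·, ·⟩_X`. -/
theorem dualPairing_inclPos {ι : X →L[ℂ] Y} (hι : Function.Injective ι) {θ : unitInterval}
    (f : InterpNeg ι θ) (x : X) : dualPairing f (inclPos ι θ x) = Interp.val f x := by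
  have : (comap (inclPos ι θ) (𝓝 (inclPos ι θ x))).NeBot :=
    comap_neBot fun t ht => ⟨x, mem_of_mem_nhds ht⟩
  refine Tendsto.limUnder_eq ?_
  rw [tendsto_iff_norm_sub_tendsto_zero]
  have h1 : Tendsto (fun x' => ‖inclPos ι θ x' - inclPos ι θ x‖)
      (comap (inclPos ι θ) (𝓝 (inclPos ι θ x))) (𝓝 0) :=
    tendsto_iff_norm_sub_tendsto_zero.1 tendsto_comap
  have h2 := h1.const_mul ‖f‖
  rw [mul_zero] at h2
  refine squeeze_zero (fun _ => norm_nonneg _) (fun x' => ?_) h2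
  rw [← map_sub, ← map_sub]
  exact norm_val_apply_le hι f (x' - x)

end Duality

/-- For `R : Z → [X^*, Y]_θ`, the operator `R^* : [X, Y]_θ → Z`: `R^* v` is the element of `Z` with
`(R^* v, w)_Z = conj ⟨R w, v⟩` for all `w` in `Z`, the pairing being that of `[X^*, Y]_θ` and
`[X, Y]_θ`. -/
def rStar {Z : Type*} [NormedAddCommGroup Z] [InnerProductSpace ℂ Z] {ι : X →L[ℂ] Y}
    {θ : unitInterval} (R : Z →L[ℂ] InterpNeg ι θ) (v : InterpPos ι θ) : Z :=
  Classical.epsilon fun z : Z => ∀ w : Z, ⟪w, z⟫_ℂ = conj (dualPairing (R w) v)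

/-- The defining identity of `R^* v` holds at the points `v` of `X`. -/
theorem inner_rStar_inclPos [CompleteSpace X] [CompleteSpace Y] {Z : Type*} [NormedAddCommGroup Z]
    [InnerProductSpace ℂ Z] [CompleteSpace Z] {ι : X →L[ℂ] Y} (hι : Function.Injective ι)
    {θ : unitInterval} (R : Z →L[ℂ] InterpNeg ι θ) (x : X) (w : Z) :
    ⟪w, rStar R (inclPos ι θ x)⟫_ℂ = conj (Interp.val (R w) x) := by
  have hex : ∃ z : Z, ∀ w : Z, ⟪w, z⟫_ℂ = conj (dualPairing (R w) (inclPos ι θ x)) := by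
    let φ : Z →L[ℂ] ℂ := LinearMap.mkContinuous
      { toFun := fun w => Interp.val (R w) x
        map_add' := fun w w' => by simp
        map_smul' := fun c w => by simp }
      (‖R‖ * ‖inclPos ι θ x‖)
      (fun w => by
        refine (norm_val_apply_le hι (R w) x).trans ?_
        calc ‖R w‖ * ‖inclPos ι θ x‖ ≤ (‖R‖ * ‖w‖) * ‖inclPos ι θ x‖ := by
              gcongr; exact R.le_opNorm w
          _ = _ := by ring)
    refine ⟨(InnerProductSpace.toDual ℂ Z).symm φ, fun w => ?_⟩
    rw [← inner_conj_symm, InnerProductSpace.toDual_symm_apply, dualPairing_inclPos hι]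
    rfl
  rw [← dualPairing_inclPos hι]
  exact Classical.epsilon_spec hex w

end Triple

/-- The open sector `{r e^{iγ} : r > 0, -θ < γ < θ}`. -/
def sector (θ : ℝ) : Set ℂ := {z | ∃ r γ : ℝ, 0 < r ∧ -θ < γ ∧ γ < θ ∧ z = r * cexp (γ * I)}

section Resolvent

variable {E F : Type*} [NormedAddCommGroup E] [NormedSpace ℂ E]
  [NormedAddCommGroup F] [NormedSpace ℂ F]

/-- The resolvent set of the operator `A` in `F` with domain `E`, where `E ⊂ F` through `i`: the set
of all `z` such that `z - A` has a bounded inverse from `F` to `E`. -/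
def resolventSet (i A : E →L[ℂ] F) : Set ℂ := {z | (z • i - A).IsInvertible}

/-- The resolvent `R(z, A)`, as an operator from `F` to the domain `E` of `A`. -/
def resolventOp (i A : E →L[ℂ] F) (z : ℂ) : F →L[ℂ] E := (z • i - A).inverse

/-- The integral of `f` along the contour `{r e^{-iθ} : r ≥ 0} ∪ {r e^{iθ} : r > 0}`, oriented with
the negative real axis to its left: from `∞ e^{-iθ}` to `0` and on to `∞ e^{iθ}`. -/
def sectorIntegral {G : Type*} [NormedAddCommGroup G] [NormedSpace ℂ G] (θ : ℝ) (f : ℂ → G) : G :=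
  (∫ r in Ioi (0 : ℝ), cexp (θ * I) • f (r * cexp (θ * I))) -
    ∫ r in Ioi (0 : ℝ), cexp (-θ * I) • f (r * cexp (-θ * I))

/-- `E(t) = (2πi)⁻¹ ∫ e^{tz} R(z^α, A) dz`, the integral being along the boundary of the sector of
half-angle `ω`, with the principal branch of the power. -/
def solutionOp (i A : E →L[ℂ] F) (ω α t : ℝ) : F →L[ℂ] E :=
  (2 * Real.pi * I : ℂ)⁻¹ •
    sectorIntegral ω fun z => cexp (t * z) • resolventOp i A (z ^ (α : ℂ))

end Resolvent

section Control

variable {X Y : Type*} [NormedAddCommGroup X] [InnerProductSpace ℂ X]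
  [NormedAddCommGroup Y] [InnerProductSpace ℂ Y]

/-- The assumptions on the two bounded operators `A`, `A^*` from `X` to `Y`, where `X ⊂ Y` through
`ι`. -/
structure IsSectorialPair (ι A As : X →L[ℂ] Y) (ω₀ c₀ c₁ M₀ : ℝ) : Prop where
  omega_gt : Real.pi / 2 < ω₀
  omega_lt : ω₀ < Real.pi
  c₀_pos : 0 < c₀
  c₁_pos : 0 < c₁
  M₀_pos : 0 < M₀
  resolvent_subset : sector ω₀ ∪ {0} ⊆ resolventSet ι A
  resolvent_subset_adj : sector ω₀ ∪ {0} ⊆ resolventSet ι As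
  norm_resolvent_le : ∀ z ∈ sector ω₀, ‖ι ∘L resolventOp ι A z‖ ≤ M₀ / (1 + ‖z‖)
  norm_resolvent_le_adj : ∀ z ∈ sector ω₀, ‖ι ∘L resolventOp ι As z‖ ≤ M₀ / (1 + ‖z‖)
  adjoint : ∀ v w : X, ⟪ι w, A v⟫_ℂ = ⟪As w, ι v⟫_ℂ
  norm_bounds : ∀ v : X, c₀ * ‖v‖ ≤ ‖A v‖ ∧ ‖A v‖ ≤ c₁ * ‖v‖
  norm_bounds_adj : ∀ v : X, c₀ * ‖v‖ ≤ ‖As v‖ ∧ ‖As v‖ ≤ c₁ * ‖v‖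

/-- `E_α(t)` on `X^*`, with values in `Y`.  Here `A` is extended to an operator from `Y` to `X^*` by
`⟨A v, w⟩_X = (v, A^* w)_Y`. -/
def forwardOp (ι As : X →L[ℂ] Y) (ω₀ α t : ℝ) : AntiDual X →L[ℂ] Y :=
  solutionOp (transpose ι) (transpose As) ω₀ α t

/-- The adjoint `E_α^*(t)`, as an operator from `Y` to `X`.  It is given by
`(2πi)⁻¹ ∫ e^{tz} R(z^α, A^*) dz` along the boundary of the sector. -/
def backwardOp (ι As : X →L[ℂ] Y) (ω₀ α t : ℝ) : Y →L[ℂ] X := solutionOp ι As ω₀ α t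

variable {Z : Type*} [NormedAddCommGroup Z] [InnerProductSpace ℂ Z]

/-- The integrand `s ↦ E_α(t - s) R u(s)` of the mild solution. -/
def stateIntegrand {ι : X →L[ℂ] Y} (As : X →L[ℂ] Y) (ω₀ α : ℝ) {θ₀ : unitInterval}
    (R : Z →L[ℂ] InterpNeg ι θ₀) (u : ℝ → Z) (t s : ℝ) : Y :=
  forwardOp ι As ω₀ α (t - s) (Interp.val (R (u s)))

/-- `S_α R u`, the mild solution of `(D^α - A) w = R u`, `w(0) = 0`. -/
def state {ι : X →L[ℂ] Y} (As : X →L[ℂ] Y) (ω₀ α : ℝ) {θ₀ : unitInterval}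
    (R : Z →L[ℂ] InterpNeg ι θ₀) (u : ℝ → Z) (t : ℝ) : Y :=
  ∫ s in (0 : ℝ)..t, stateIntegrand As ω₀ α R u t s

/-- `S_α^* (q δ_T)`, the mild solution of the backward equation with the right-hand side `q δ_T`,
as a function with values in `[X, Y]_θ`. -/
def adjointState (ι As : X →L[ℂ] Y) (ω₀ α T : ℝ) (θ₀ : unitInterval) (q : Y) (t : ℝ) :
    InterpPos ι θ₀ :=
  inclPos ι θ₀ (backwardOp ι As ω₀ α (T - t) q)

/-- `L²(0, T; Z)`. -/
abbrev ControlSpace (Z : Type*) [NormedAddCommGroup Z] (T : ℝ) : Type _ :=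
  Lp Z 2 (volume.restrict (Ioo (0 : ℝ) T))

/-- The cost functional `J_α`. -/
def cost {ι : X →L[ℂ] Y} (As : X →L[ℂ] Y) (ω₀ α T : ℝ) {θ₀ : unitInterval}
    (R : Z →L[ℂ] InterpNeg ι θ₀) (yd : Y) (ν : ℝ) (u : ControlSpace Z T) : ℝ :=
  1 / 2 * ‖state As ω₀ α R u T - yd‖ ^ 2 + ν / 2 * ‖u‖ ^ 2

end Control

end FracControl

end

/-!
The resolvent of `A^*` obeys the bounds `‖R(z, A^*)‖ ≤ M / (1 + |z|)` on `Y` and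
`‖R(z, A^*)‖ ≤ (M + 1) / c₀` from `Y` to `X` up to the boundary of the sector
(`norm_resolventOp_le_of_mem_closure`).  Since `z - A`, as an operator from `Y` to `X^*`, is the
transpose of `conj z - A^*`, its inverse exists, is dual to `R(conj z, A^*)`, and inherits the bounds.
Integration along the contour, which is symmetric in the real axis, shows that `E_α(t)` is the
adjoint of `E_α^*(t)` (`IsSectorialPair.inner_forwardOp`), and that its norm is of order `t⁻¹` from
`X^*` to `Y` and of order `t ^ (α / 2 - 1)` on `Y`.  By the three lines theorem
(`Interp.norm_map_val_le`) its norm from `[X^*, Y]_θ` to `Y` is of order `t ^ (α θ / 2 - 1)`, which is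
integrable at `0` because `θ > 0`.  Hence the integrals defining the state converge for bounded
controls.

For small `α θ` this kernel is not square integrable, so that the map from the control `u` to the
final state `S u` need not extend continuously to `L²`.  It is continuous, for the norm of `L²`, on
bounded subsets of `L^∞` (`continuousOn_integral_clm_apply`), and the admissible set is one:
this follows from Baire's theorem and convexity (`exists_ae_norm_le_of_forall_memLp_top`).
The graph of `u ↦ (S u - y_d, √ν u)` over the admissible set is therefore a closed convex set, and
twice the cost is the square of the distance to the origin on it.  Existence, uniqueness and the
variational inequality are those of the projection to a closed convex set of a Hilbert space
(`exists_minimizer_of_convex`).  The duality of `E_α(T - t)` and `E_α^*(T - t)`, pointwise in `t`,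
turns the inequality into the one for the adjoint state
(`integrable_and_integral_inner_adjoint`).
-/

namespace FracControl

/-! ### Resolvents up to the boundary of the sector -/

section Resolvents

variable {E F : Type*} [NormedAddCommGroup E] [NormedSpace ℂ E]
  [NormedAddCommGroup F] [NormedSpace ℂ F] {i B : E →L[ℂ] F} {ω c M : ℝ}

theorem mem_closure_sector {ω r γ : ℝ} (hω : 0 < ω) (hr : 0 < r) (hγ : |γ| ≤ ω) :
    (r : ℂ) * cexp (γ * I) ∈ closure (sector ω) := by
  have hc : Continuous fun γ : ℝ => (r : ℂ) * cexp (γ * I) := by fun_prop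
  have hmem : γ ∈ closure (Ioo (-ω) ω) := by
    rw [closure_Ioo (by linarith)]
    exact abs_le.1 hγ
  exact map_mem_closure (f := fun γ : ℝ => (r : ℂ) * cexp (γ * I)) hc hmem fun γ' hγ' => ⟨r, γ', hr, hγ'.1, hγ'.2, rfl⟩

theorem continuousAt_resolventOp [CompleteSpace E] {z : ℂ} (hz : z ∈ resolventSet i B) :
    ContinuousAt (resolventOp i B) z := by
  obtain ⟨e, he⟩ := hz
  have h1 : ContinuousAt ContinuousLinearMap.inverse (z • i - B) := by
    rw [← he]
    exact (contDiffAt_map_inverse (𝕜 := ℂ) (n := 0) e).continuousAt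
  exact ContinuousAt.comp (f := fun w : ℂ => w • i - B) h1 (by fun_prop)

/-- From the identity `B R(z, B) = z R(z, B) - 1` and the bound of `v` by `B v`. -/
theorem norm_resolventOp_le (hres : sector ω ⊆ resolventSet i B) (hc : 0 < c) (hM : 0 ≤ M)
    (hbd : ∀ z ∈ sector ω, ‖i ∘L resolventOp i B z‖ ≤ M / (1 + ‖z‖))
    (hB : ∀ v, c * ‖v‖ ≤ ‖B v‖) {z : ℂ} (hz : z ∈ sector ω) :
    ‖resolventOp i B z‖ ≤ (M + 1) / c := by
  refine ContinuousLinearMap.opNorm_le_bound _ (by positivity) fun y => ?_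
  have h1 : z • i (resolventOp i B z y) - B (resolventOp i B z y) = y :=
    (hres hz).self_apply_inverse y
  have h2 : B (resolventOp i B z y) = z • i (resolventOp i B z y) - y := by
    rw [eq_sub_iff_add_eq, ← eq_sub_iff_add_eq', h1]
  have h3 : ‖z • i (resolventOp i B z y)‖ ≤ M * ‖y‖ := by
    rw [norm_smul]
    have h4 : ‖i (resolventOp i B z y)‖ ≤ M / (1 + ‖z‖) * ‖y‖ :=
      ((i ∘L resolventOp i B z).le_opNorm y).trans (by gcongr; exact hbd z hz)
    calc ‖z‖ * ‖i (resolventOp i B z y)‖ ≤ ‖z‖ * (M / (1 + ‖z‖) * ‖y‖) := by gcongr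
      _ = (‖z‖ / (1 + ‖z‖)) * (M * ‖y‖) := by ring
      _ ≤ 1 * (M * ‖y‖) := by
          gcongr
          rw [div_le_one (by positivity)]
          linarith
      _ = M * ‖y‖ := one_mul _
  have h5 := hB (resolventOp i B z y)
  rw [h2] at h5
  have h6 := norm_sub_le (z • i (resolventOp i B z y)) y
  rw [div_mul_eq_mul_div, le_div_iff₀ hc]
  linarith

/-- The resolvent bounds are uniform on the sector, so that a Neumann series reaches its boundary:
this matters for `α = 1`, where the contour of integration itself is not inside the open sector. -/
theorem closure_sector_subset_resolventSet [CompleteSpace E]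
    (hres : sector ω ⊆ resolventSet i B) (hc : 0 < c) (hM : 0 ≤ M)
    (hbd : ∀ z ∈ sector ω, ‖i ∘L resolventOp i B z‖ ≤ M / (1 + ‖z‖))
    (hB : ∀ v, c * ‖v‖ ≤ ‖B v‖) : closure (sector ω) ⊆ resolventSet i B := by
  intro w hw
  set K : ℝ := (M + 1) / c * ‖i‖ + 1 with hK
  have hK0 : 0 < K := by positivity
  obtain ⟨w', hw', hd⟩ := Metric.mem_closure_iff.1 hw K⁻¹ (by positivity)
  have hw'r := hres hw'
  set t : E →L[ℂ] E := (w' - w) • (resolventOp i B w' ∘L i) with ht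
  have ht1 : ‖t‖ < 1 := by
    have h1 : ‖resolventOp i B w' ∘L i‖ ≤ K :=
      (ContinuousLinearMap.opNorm_comp_le _ _).trans (by
        have := norm_resolventOp_le hres hc hM hbd hB hw'
        have := mul_le_mul_of_nonneg_right this (norm_nonneg i)
        linarith)
    rw [dist_comm, dist_eq_norm] at hd
    calc ‖t‖ ≤ ‖w' - w‖ * K := by
          rw [ht, norm_smul]; gcongr
      _ < K⁻¹ * K := by gcongr
      _ = 1 := inv_mul_cancel₀ hK0.ne'
  obtain ⟨U, hU⟩ := isUnit_one_sub_of_norm_lt_one ht1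
  have hinv : (1 - t).IsInvertible :=
    ⟨ContinuousLinearEquiv.unitsEquiv ℂ E U, by rw [← hU]; rfl⟩
  have hcomp : w • i - B = (w' • i - B) ∘L (1 - t) := by
    ext v
    have h1 : w' • i (resolventOp i B w' (i v)) - B (resolventOp i B w' (i v)) = i v :=
      hw'r.self_apply_inverse (i v)
    have h2 : (w' • i - B) (t v) = (w' - w) • i v := by
      rw [ht, _root_.smul_apply, map_smul]
      exact congrArg _ h1
    rw [ContinuousLinearMap.comp_apply, _root_.sub_apply (1 : E →L[ℂ] E), map_sub, h2]
    simp only [_root_.sub_apply, _root_.smul_apply, one_apply_eq_self, sub_smul]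
    abel
  change (w • i - B).IsInvertible
  rw [hcomp]
  exact hw'r.comp hinv

theorem norm_resolventOp_le_of_mem_closure [CompleteSpace E]
    (hres : sector ω ⊆ resolventSet i B) (hc : 0 < c) (hM : 0 ≤ M)
    (hbd : ∀ z ∈ sector ω, ‖i ∘L resolventOp i B z‖ ≤ M / (1 + ‖z‖))
    (hB : ∀ v, c * ‖v‖ ≤ ‖B v‖) {z : ℂ} (hz : z ∈ closure (sector ω)) :
    ‖resolventOp i B z‖ ≤ (M + 1) / c ∧ ‖i ∘L resolventOp i B z‖ ≤ M / (1 + ‖z‖) := by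
  have hcont := (continuousAt_resolventOp
    (closure_sector_subset_resolventSet hres hc hM hbd hB hz)).continuousWithinAt (s := sector ω)
  constructor
  · exact ContinuousWithinAt.closure_le hz hcont.norm continuousWithinAt_const
      fun w hw => norm_resolventOp_le hres hc hM hbd hB hw
  · refine ContinuousWithinAt.closure_le hz
      (((ContinuousLinearMap.compL ℂ F E F i).continuous.continuousAt.comp_continuousWithinAt
        hcont).norm) ?_ hbd
    refine ContinuousWithinAt.div continuousWithinAt_const (by fun_prop) ?_
    positivity

end Resolvents

/-! ### Duality of resolvents -/

section Transpose

variable {X Y : Type*} [NormedAddCommGroup X] [InnerProductSpace ℂ X]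
  [NormedAddCommGroup Y] [InnerProductSpace ℂ Y]

theorem smul_transpose_sub_transpose (i B : X →L[ℂ] Y) (z : ℂ) :
    z • transpose i - transpose B = transpose (conj z • i - B) := by
  ext v x
  simp [transpose_apply, mul_comm]

/-- The Riesz representation theorem for conjugate-linear functionals. -/
theorem exists_inner_eq_antiDual [CompleteSpace Y] (f : AntiDual Y) :
    ∃ a : Y, ∀ y, ⟪y, a⟫_ℂ = f y := by
  let g : Y →L[ℂ] ℂ := (starL ℂ : ℂ ≃L⋆[ℂ] ℂ).toContinuousLinearMap.comp f
  refine ⟨(InnerProductSpace.toDual ℂ Y).symm g, fun y => ?_⟩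
  rw [← inner_conj_symm, InnerProductSpace.toDual_symm_apply]
  change conj (conj (f y)) = f y
  simp

/-- If `B` is invertible, the solution of `transpose B v = f` represents the functional
`y ↦ ⟨f, B⁻¹ y⟩` on `Y`. -/
theorem transpose_isInvertible [CompleteSpace Y] {B : X →L[ℂ] Y} (hB : B.IsInvertible) :
    (transpose B).IsInvertible := by
  have hker : (transpose B).ker = ⊥ := by
    refine LinearMap.ker_eq_bot'.2 fun v hv => ?_
    obtain ⟨x, rfl⟩ := hB.surjective v
    have : transpose B (B x) x = 0 := by
      change (transpose B) (B x) = 0 at hv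
      rw [hv]; rfl
    rwa [transpose_apply, inner_self_eq_zero] at this
  have hrange : (transpose B).range = ⊤ := by
    refine LinearMap.range_eq_top.2 fun f => ?_
    obtain ⟨a, ha⟩ := exists_inner_eq_antiDual (f.comp B.inverse)
    refine ⟨a, ?_⟩
    ext x
    change transpose B a x = f x
    rw [transpose_apply, ha, ContinuousLinearMap.comp_apply, hB.inverse_apply_self]
  exact ⟨ContinuousLinearEquiv.ofBijective (transpose B) hker hrange,
    ContinuousLinearEquiv.coe_ofBijective _ _ _⟩

theorem inner_inverse_transpose [CompleteSpace Y] {B : X →L[ℂ] Y} (hB : B.IsInvertible)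
    (f : AntiDual X) (y : Y) : ⟪y, (transpose B).inverse f⟫_ℂ = f (B.inverse y) := by
  conv_lhs => rw [← hB.self_apply_inverse y]
  rw [← transpose_apply, (transpose_isInvertible hB).self_apply_inverse]

theorem conj_mem_resolventSet_transpose [CompleteSpace Y] {i B : X →L[ℂ] Y} {z : ℂ}
    (hz : conj z ∈ resolventSet i B) : z ∈ resolventSet (transpose i) (transpose B) := by
  change (z • transpose i - transpose B).IsInvertible
  rw [smul_transpose_sub_transpose]
  exact transpose_isInvertible hz

theorem inner_resolventOp_transpose [CompleteSpace Y] {i B : X →L[ℂ] Y} {z : ℂ}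
    (hz : conj z ∈ resolventSet i B) (f : AntiDual X) (y : Y) :
    ⟪y, resolventOp (transpose i) (transpose B) z f⟫_ℂ = f (resolventOp i B (conj z) y) := by
  rw [resolventOp, smul_transpose_sub_transpose, inner_inverse_transpose hz]
  rfl

/-- A bound for `|(y, v)|` by a multiple of `‖y‖` bounds `‖v‖`. -/
theorem norm_le_of_norm_inner_le {v : Y} {C : ℝ} (hC : 0 ≤ C)
    (h : ∀ y : Y, ‖⟪y, v⟫_ℂ‖ ≤ C * ‖y‖) : ‖v‖ ≤ C := by
  have h1 := h v
  rw [inner_self_eq_norm_sq_to_K] at h1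
  simp only [Complex.coe_algebraMap, norm_pow, Complex.norm_real, norm_norm] at h1
  by_contra! hlt
  nlinarith [norm_nonneg v]

theorem norm_resolventOp_transpose_le [CompleteSpace Y] {i B : X →L[ℂ] Y} {z : ℂ}
    (hz : conj z ∈ resolventSet i B) :
    ‖resolventOp (transpose i) (transpose B) z‖ ≤ ‖resolventOp i B (conj z)‖ := by
  refine ContinuousLinearMap.opNorm_le_bound _ (norm_nonneg _) fun f => ?_
  refine norm_le_of_norm_inner_le (by positivity) fun y => ?_
  rw [inner_resolventOp_transpose hz]
  refine (f.le_opNorm _).trans ?_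
  calc ‖f‖ * ‖resolventOp i B (conj z) y‖
      ≤ ‖f‖ * (‖resolventOp i B (conj z)‖ * ‖y‖) := by
        gcongr; exact ContinuousLinearMap.le_opNorm _ _
    _ = _ := by ring

theorem norm_resolventOp_transpose_comp_le [CompleteSpace Y] {i B : X →L[ℂ] Y} {z : ℂ}
    (hz : conj z ∈ resolventSet i B) :
    ‖resolventOp (transpose i) (transpose B) z ∘L transpose i‖
      ≤ ‖i ∘L resolventOp i B (conj z)‖ := by
  refine ContinuousLinearMap.opNorm_le_bound _ (norm_nonneg _) fun v => ?_
  refine norm_le_of_norm_inner_le (by positivity) fun y => ?_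
  rw [ContinuousLinearMap.comp_apply, inner_resolventOp_transpose hz, transpose_apply]
  refine (norm_inner_le_norm _ _).trans ?_
  calc ‖i (resolventOp i B (conj z) y)‖ * ‖v‖
      ≤ (‖i ∘L resolventOp i B (conj z)‖ * ‖y‖) * ‖v‖ := by
        gcongr; exact (i ∘L resolventOp i B (conj z)).le_opNorm y
    _ = _ := by ring

end Transpose

/-! ### Laplace transforms along a ray -/

section Ray

variable {G H : Type*} [NormedAddCommGroup G] [NormedSpace ℂ G]
  [NormedAddCommGroup H] [NormedSpace ℂ H] {k : ℝ → G} {σ β C : ℝ}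

/-- The integrand `e^{iσ} e^{tz} k`, at `z = r e^{iσ}`, of a Laplace transform along the ray of
angle `σ`. -/
noncomputable def rayIntegrand (σ : ℝ) (k : ℝ → G) (t r : ℝ) : G :=
  cexp (σ * I) • cexp (t * (r * cexp (σ * I))) • k r

/-- The integral of `e^{tz} k(|z|) dz` along the ray of angle `σ`. -/
noncomputable def rayTransform (σ : ℝ) (k : ℝ → G) (t : ℝ) : G := ∫ r in Ioi (0 : ℝ), rayIntegrand σ k t r

theorem norm_rayIntegrand (t r : ℝ) :
    ‖rayIntegrand σ k t r‖ = Real.exp (t * Real.cos σ * r) * ‖k r‖ := by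
  rw [rayIntegrand, norm_smul, norm_smul, Complex.norm_exp_ofReal_mul_I, one_mul,
    Complex.norm_exp]
  congr 2
  rw [Complex.re_ofReal_mul, Complex.re_ofReal_mul, Complex.exp_ofReal_mul_I_re]
  ring

theorem aestronglyMeasurable_rayIntegrand (hk : ContinuousOn k (Ioi 0)) (t : ℝ) :
    AEStronglyMeasurable (rayIntegrand σ k t) (volume.restrict (Ioi 0)) := by
  refine ContinuousOn.aestronglyMeasurable ?_ measurableSet_Ioi
  unfold rayIntegrand
  have h : Continuous fun r : ℝ => cexp (t * (r * cexp (σ * I))) := by fun_prop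
  exact (h.continuousOn.smul hk).const_smul _

theorem integrableOn_rpow_mul_exp {a : ℝ} (hβ : β < 1) (ha : 0 < a) :
    IntegrableOn (fun r : ℝ => r ^ (-β) * Real.exp (-(a * r))) (Ioi 0) := by
  have := integrableOn_rpow_mul_exp_neg_mul_rpow (p := 1) (s := -β) (b := a) (by linarith)
    one_pos ha
  refine this.congr_fun (fun r _ => ?_) measurableSet_Ioi
  simp [neg_mul]

/-- The integrand is dominated uniformly for `t` bounded away from `0`. -/
theorem norm_rayIntegrand_le (hσ : Real.cos σ < 0) (hC : ∀ r, 0 < r → ‖k r‖ ≤ C * r ^ (-β))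
    {s t : ℝ} (hst : s ≤ t) {r : ℝ} (hr : 0 < r) :
    ‖rayIntegrand σ k t r‖ ≤ C * (r ^ (-β) * Real.exp (-(s * -Real.cos σ * r))) := by
  rw [norm_rayIntegrand]
  have h1 : Real.exp (t * Real.cos σ * r) ≤ Real.exp (-(s * -Real.cos σ * r)) := by
    refine Real.exp_le_exp.2 ?_
    have : 0 ≤ (t - s) * (-Real.cos σ * r) :=
      mul_nonneg (by linarith) (mul_nonneg (by linarith) hr.le)
    nlinarith
  calc _ ≤ Real.exp (-(s * -Real.cos σ * r)) * (C * r ^ (-β)) :=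
        mul_le_mul h1 (hC r hr) (norm_nonneg _) (Real.exp_pos _).le
    _ = _ := by ring

theorem integrableOn_rayIntegrand (hk : ContinuousOn k (Ioi 0)) (hσ : Real.cos σ < 0)
    (hβ : β < 1) (hC : ∀ r, 0 < r → ‖k r‖ ≤ C * r ^ (-β)) {t : ℝ} (ht : 0 < t) :
    IntegrableOn (rayIntegrand σ k t) (Ioi 0) := by
  have hbound := (integrableOn_rpow_mul_exp hβ
    (mul_pos ht (neg_pos.2 hσ))).const_mul C
  refine Integrable.mono' hbound (aestronglyMeasurable_rayIntegrand hk t) ?_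
  filter_upwards [ae_restrict_mem measurableSet_Ioi] with r hr
  exact norm_rayIntegrand_le hσ hC le_rfl hr

/-- The bound is the Gamma integral. -/
theorem norm_rayTransform_le (hσ : Real.cos σ < 0)
    (hβ : β < 1) (hC : ∀ r, 0 < r → ‖k r‖ ≤ C * r ^ (-β)) {t : ℝ} (ht : 0 < t) :
    ‖rayTransform σ k t‖
      ≤ C * (-Real.cos σ) ^ (β - 1) * Real.Gamma (1 - β) * t ^ (β - 1) := by
  have hc : 0 < -Real.cos σ := neg_pos.2 hσ
  have ha := mul_pos ht hc
  refine (norm_integral_le_of_norm_le ((integrableOn_rpow_mul_exp hβ ha).const_mul C)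
    (by
      filter_upwards [ae_restrict_mem measurableSet_Ioi] with r hr
      exact norm_rayIntegrand_le hσ hC le_rfl hr)).trans (le_of_eq ?_)
  rw [integral_const_mul]
  have := Real.integral_rpow_mul_exp_neg_mul_Ioi (a := 1 - β) (by linarith) ha
  rw [show (1 - β - 1 : ℝ) = -β by ring] at this
  rw [this, one_div, Real.inv_rpow ha.le, ← Real.rpow_neg ha.le, neg_sub,
    Real.mul_rpow ht.le hc.le]
  ring

theorem continuousOn_rayTransform (hk : ContinuousOn k (Ioi 0)) (hσ : Real.cos σ < 0)
    (hβ : β < 1) (hC : ∀ r, 0 < r → ‖k r‖ ≤ C * r ^ (-β)) :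
    ContinuousOn (rayTransform σ k) (Ioi 0) := by
  intro t ht
  have ht : 0 < t := ht
  refine ContinuousAt.continuousWithinAt ?_
  refine continuousAt_of_dominated
    (bound := fun r => C * (r ^ (-β) * Real.exp (-(t / 2 * -Real.cos σ * r))))
    (Eventually.of_forall fun s => aestronglyMeasurable_rayIntegrand hk s) ?_
    ((integrableOn_rpow_mul_exp hβ (mul_pos (half_pos ht) (neg_pos.2 hσ))).const_mul C) ?_
  · filter_upwards [lt_mem_nhds (half_lt_self ht)] with s hs
    filter_upwards [ae_restrict_mem measurableSet_Ioi] with r hr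
    exact norm_rayIntegrand_le hσ hC hs.le hr
  · refine Eventually.of_forall fun r => Continuous.continuousAt ?_
    unfold rayIntegrand
    fun_prop

theorem map_rayTransform [CompleteSpace G] [CompleteSpace H] (L : G →L[ℂ] H)
    (hk : ContinuousOn k (Ioi 0)) (hσ : Real.cos σ < 0)
    (hβ : β < 1) (hC : ∀ r, 0 < r → ‖k r‖ ≤ C * r ^ (-β)) {t : ℝ} (ht : 0 < t) :
    L (rayTransform σ k t) = rayTransform σ (fun r => L (k r)) t := by
  unfold rayTransform
  rw [← L.integral_comp_comm (integrableOn_rayIntegrand hk hσ hβ hC ht)]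
  simp [rayIntegrand]

/-- Conjugation reflects the ray in the real axis. -/
theorem conj_rayTransform (k : ℝ → ℂ) (σ t : ℝ) :
    conj (rayTransform σ k t) = rayTransform (-σ) (fun r => conj (k r)) t := by
  unfold rayTransform
  rw [← integral_conj]
  simp [rayIntegrand, ← Complex.exp_conj]

end Ray

theorem ray_cpow {r σ : ℝ} (hr : 0 < r) (hσ : |σ| < Real.pi) (α : ℝ) :
    ((r : ℂ) * cexp (σ * I)) ^ (α : ℂ) = ((r ^ α : ℝ) : ℂ) * cexp ((α * σ : ℝ) * I) := by
  have hσ' := abs_lt.1 hσ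
  have hlog : Complex.log ((r : ℂ) * cexp (σ * I)) = Real.log r + σ * I := by
    rw [Complex.log_ofReal_mul hr (Complex.exp_ne_zero _), Complex.log_exp] <;> simp
    · exact hσ'.1
    · exact hσ'.2.le
  have hne : (r : ℂ) * cexp (σ * I) ≠ 0 :=
    mul_ne_zero (by exact_mod_cast hr.ne') (Complex.exp_ne_zero _)
  rw [Complex.cpow_def_of_ne_zero hne, hlog, Real.rpow_def_of_pos hr, Complex.ofReal_exp,
    ← Complex.exp_add]
  congr 1
  push_cast
  ring

/-! ### Solution operators -/

section Solution

variable {E F : Type*} [NormedAddCommGroup E] [NormedSpace ℂ E]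
  [NormedAddCommGroup F] [NormedSpace ℂ F]

/-- The resolvent `R(z^α, B)` along the ray `z = r e^{iσ}`. -/
noncomputable def rayResolvent (i B : E →L[ℂ] F) (α σ r : ℝ) : F →L[ℂ] E :=
  resolventOp i B (((r : ℂ) * cexp (σ * I)) ^ (α : ℂ))

theorem solutionOp_eq_rayTransform (i B : E →L[ℂ] F) (ω α t : ℝ) :
    solutionOp i B ω α t = (2 * Real.pi * I : ℂ)⁻¹ •
      (rayTransform ω (rayResolvent i B α ω) t - rayTransform (-ω) (rayResolvent i B α (-ω)) t) := by
  simp only [solutionOp, sectorIntegral, rayTransform, rayIntegrand, rayResolvent,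
    Complex.ofReal_neg]

theorem map_solutionOp {G : Type*} [NormedAddCommGroup G] [NormedSpace ℂ G]
    (L : (F →L[ℂ] E) →L[ℂ] G) (i B : E →L[ℂ] F) (ω α t : ℝ) :
    L (solutionOp i B ω α t) = (2 * Real.pi * I : ℂ)⁻¹ •
      (L (rayTransform ω (rayResolvent i B α ω) t)
        - L (rayTransform (-ω) (rayResolvent i B α (-ω)) t)) := by
  rw [solutionOp_eq_rayTransform, map_smul, map_sub]

theorem ray_cpow_mem_closure_sector {ω σ α r : ℝ} (hω : 0 < ω) (hωπ : ω < Real.pi)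
    (hσ : |σ| ≤ ω) (hα : 0 ≤ α) (hα1 : α ≤ 1) (hr : 0 < r) :
    ((r : ℂ) * cexp (σ * I)) ^ (α : ℂ) ∈ closure (sector ω) := by
  rw [ray_cpow hr (hσ.trans_lt hωπ)]
  refine mem_closure_sector hω (Real.rpow_pos_of_pos hr α) ?_
  rw [abs_mul, abs_of_nonneg hα]
  nlinarith [abs_nonneg σ]

theorem norm_ray_cpow {σ r : ℝ} (hσ : |σ| < Real.pi) (hr : 0 < r) (α : ℝ) :
    ‖((r : ℂ) * cexp (σ * I)) ^ (α : ℂ)‖ = r ^ α := by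
  rw [ray_cpow hr hσ, norm_mul, Complex.norm_exp_ofReal_mul_I, mul_one, Complex.norm_real,
    Real.norm_of_nonneg (Real.rpow_nonneg hr.le α)]

theorem conj_ray_cpow {σ r : ℝ} (hσ : |σ| < Real.pi) (hr : 0 < r) (α : ℝ) :
    conj (((r : ℂ) * cexp (σ * I)) ^ (α : ℂ)) =
      ((r : ℂ) * cexp (((-σ : ℝ) : ℂ) * I)) ^ (α : ℂ) := by
  rw [ray_cpow hr hσ, ray_cpow hr (by rwa [abs_neg])]
  simp [← Complex.exp_conj]

theorem continuousOn_rayResolvent [CompleteSpace E] {i B : E →L[ℂ] F} {σ : ℝ} (α : ℝ)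
    (hσ : |σ| < Real.pi)
    (hres : ∀ r : ℝ, 0 < r → ((r : ℂ) * cexp (σ * I)) ^ (α : ℂ) ∈ resolventSet i B) :
    ContinuousOn (rayResolvent i B α σ) (Ioi 0) := by
  intro r hr
  refine ContinuousAt.continuousWithinAt ?_
  refine ContinuousAt.comp (f := fun r : ℝ => ((r : ℂ) * cexp (σ * I)) ^ (α : ℂ))
    (continuousAt_resolventOp (hres r hr)) ?_
  have h : ContinuousAt (fun r : ℝ => ((r ^ α : ℝ) : ℂ) * cexp ((α * σ : ℝ) * I)) r := by
    have h1 : ContinuousAt (fun r : ℝ => r ^ α) r :=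
      Real.continuousAt_rpow_const _ _ (Or.inl (ne_of_gt hr))
    exact (Complex.continuous_ofReal.continuousAt.comp h1).mul continuousAt_const
  refine h.congr ?_
  filter_upwards [Ioi_mem_nhds hr] with s hs
  exact (ray_cpow hs hσ α).symm

/-- A function of size `r^{-β}` on each of the two rays gives a contour integral of size
`t^{β - 1}`. -/
theorem exists_norm_sub_rayTransform_le {G : Type*} [NormedAddCommGroup G] [NormedSpace ℂ G]
    {ω β C : ℝ} (hω : Real.cos ω < 0) (hβ : β < 1) (hC0 : 0 ≤ C) {k₁ k₂ : ℝ → G}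
    (h₁ : ∀ r, 0 < r → ‖k₁ r‖ ≤ C * r ^ (-β)) (h₂ : ∀ r, 0 < r → ‖k₂ r‖ ≤ C * r ^ (-β)) :
    ∃ K, 0 ≤ K ∧ ∀ t, 0 < t → ‖(2 * Real.pi * I : ℂ)⁻¹ •
      (rayTransform ω k₁ t - rayTransform (-ω) k₂ t)‖ ≤ K * t ^ (β - 1) := by
  set D : ℝ := C * (-Real.cos ω) ^ (β - 1) * Real.Gamma (1 - β) with hD
  have hD0 : 0 ≤ D := mul_nonneg (mul_nonneg hC0 (Real.rpow_nonneg (by linarith) _))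
    (Real.Gamma_pos_of_pos (by linarith)).le
  refine ⟨‖(2 * Real.pi * I : ℂ)⁻¹‖ * (D + D), by positivity, fun t ht => ?_⟩
  rw [norm_smul, mul_assoc _ (D + D)]
  refine mul_le_mul_of_nonneg_left
    ((norm_sub_le (rayTransform ω k₁ t) (rayTransform (-ω) k₂ t)).trans ?_) (norm_nonneg _)
  have e1 := norm_rayTransform_le hω hβ h₁ ht
  have e2 := norm_rayTransform_le (σ := -ω) (by rwa [Real.cos_neg]) hβ h₂ ht
  rw [Real.cos_neg] at e2
  rw [add_mul]
  exact add_le_add e1 e2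

theorem continuousOn_solutionOp {i B : E →L[ℂ] F} {ω α C : ℝ} (hω : Real.cos ω < 0)
    (h₁ : ContinuousOn (rayResolvent i B α ω) (Ioi 0))
    (h₂ : ContinuousOn (rayResolvent i B α (-ω)) (Ioi 0))
    (hC₁ : ∀ r, 0 < r → ‖rayResolvent i B α ω r‖ ≤ C)
    (hC₂ : ∀ r, 0 < r → ‖rayResolvent i B α (-ω) r‖ ≤ C) :
    ContinuousOn (solutionOp i B ω α) (Ioi 0) := by
  rw [show solutionOp i B ω α = _ from funext fun t => solutionOp_eq_rayTransform i B ω α t]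
  refine ContinuousOn.fun_const_smul (ContinuousOn.fun_sub ?_ ?_) _
  · exact continuousOn_rayTransform (β := 0) (C := C) h₁ hω one_pos
      fun r hr => by simpa using hC₁ r hr
  · exact continuousOn_rayTransform (β := 0) (C := C) h₂ (by rwa [Real.cos_neg]) one_pos
      fun r hr => by simpa using hC₂ r hr

end Solution

namespace IsSectorialPair

variable {X Y : Type*} [NormedAddCommGroup X] [InnerProductSpace ℂ X]
  [NormedAddCommGroup Y] [InnerProductSpace ℂ Y]
  {ι A As : X →L[ℂ] Y} {ω₀ c₀ c₁ M₀ : ℝ}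

theorem cos_neg (h : IsSectorialPair ι A As ω₀ c₀ c₁ M₀) : Real.cos ω₀ < 0 :=
  Real.cos_neg_of_pi_div_two_lt_of_lt h.omega_gt
    (by linarith [h.omega_lt, Real.pi_pos])

theorem omega_pos (h : IsSectorialPair ι A As ω₀ c₀ c₁ M₀) : 0 < ω₀ :=
  (by positivity : 0 < Real.pi / 2).trans h.omega_gt

variable [CompleteSpace X]

theorem ray_mem_resolventSet (h : IsSectorialPair ι A As ω₀ c₀ c₁ M₀) {α σ r : ℝ}
    (hα : 0 < α) (hα1 : α ≤ 1) (hσ : |σ| ≤ ω₀) (hr : 0 < r) :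
    ((r : ℂ) * cexp (σ * I)) ^ (α : ℂ) ∈ resolventSet ι As :=
  closure_sector_subset_resolventSet (subset_union_left.trans h.resolvent_subset_adj) h.c₀_pos
    h.M₀_pos.le h.norm_resolvent_le_adj (fun v => (h.norm_bounds_adj v).1)
    (ray_cpow_mem_closure_sector h.omega_pos h.omega_lt hσ hα.le hα1 hr)

theorem norm_rayResolvent_le (h : IsSectorialPair ι A As ω₀ c₀ c₁ M₀) {α σ r : ℝ}
    (hα : 0 < α) (hα1 : α ≤ 1) (hσ : |σ| ≤ ω₀) (hr : 0 < r) :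
    ‖rayResolvent ι As α σ r‖ ≤ (M₀ + 1) / c₀ ∧
      ‖ι ∘L rayResolvent ι As α σ r‖ ≤ M₀ * r ^ (-(α / 2)) := by
  have hmem := ray_cpow_mem_closure_sector h.omega_pos h.omega_lt hσ hα.le hα1 hr
  obtain ⟨h1, h2⟩ := norm_resolventOp_le_of_mem_closure
    (subset_union_left.trans h.resolvent_subset_adj) h.c₀_pos
    h.M₀_pos.le h.norm_resolvent_le_adj (fun v => (h.norm_bounds_adj v).1) hmem
  refine ⟨h1, h2.trans ?_⟩
  rw [norm_ray_cpow (hσ.trans_lt h.omega_lt) hr, Real.rpow_neg hr.le, ← div_eq_mul_inv]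
  have hx : 0 < r ^ (α / 2) := Real.rpow_pos_of_pos hr _
  have hsq : r ^ α = r ^ (α / 2) * r ^ (α / 2) := by
    rw [← Real.rpow_add hr]; congr 1; ring
  refine div_le_div_of_nonneg_left h.M₀_pos.le hx ?_
  -- With `x = r ^ (α / 2)` the claim is `x ≤ 1 + x²`.
  rw [hsq]
  nlinarith [sq_nonneg (r ^ (α / 2) - 1)]

theorem continuousOn_rayResolvent (h : IsSectorialPair ι A As ω₀ c₀ c₁ M₀) {α σ : ℝ}
    (hα : 0 < α) (hα1 : α ≤ 1) (hσ : |σ| ≤ ω₀) :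
    ContinuousOn (rayResolvent ι As α σ) (Ioi 0) :=
  FracControl.continuousOn_rayResolvent α (hσ.trans_lt h.omega_lt)
    fun _ hr => h.ray_mem_resolventSet hα hα1 hσ hr

theorem ray_mem_resolventSet_conj (h : IsSectorialPair ι A As ω₀ c₀ c₁ M₀) {α σ r : ℝ}
    (hα : 0 < α) (hα1 : α ≤ 1) (hσ : |σ| ≤ ω₀) (hr : 0 < r) :
    conj (((r : ℂ) * cexp (σ * I)) ^ (α : ℂ)) ∈ resolventSet ι As := by
  rw [conj_ray_cpow (hσ.trans_lt h.omega_lt) hr]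
  exact h.ray_mem_resolventSet hα hα1 (by rwa [abs_neg]) hr

variable [CompleteSpace Y]

theorem continuousOn_rayResolvent_transpose (h : IsSectorialPair ι A As ω₀ c₀ c₁ M₀) {α σ : ℝ}
    (hα : 0 < α) (hα1 : α ≤ 1) (hσ : |σ| ≤ ω₀) :
    ContinuousOn (rayResolvent (transpose ι) (transpose As) α σ) (Ioi 0) :=
  FracControl.continuousOn_rayResolvent α (hσ.trans_lt h.omega_lt)
    fun _ hr => conj_mem_resolventSet_transpose (h.ray_mem_resolventSet_conj hα hα1 hσ hr)

theorem norm_rayResolvent_transpose_le (h : IsSectorialPair ι A As ω₀ c₀ c₁ M₀) {α σ r : ℝ}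
    (hα : 0 < α) (hα1 : α ≤ 1) (hσ : |σ| ≤ ω₀) (hr : 0 < r) :
    ‖rayResolvent (transpose ι) (transpose As) α σ r‖ ≤ (M₀ + 1) / c₀ ∧
      ‖rayResolvent (transpose ι) (transpose As) α σ r ∘L transpose ι‖
        ≤ M₀ * r ^ (-(α / 2)) := by
  have hmem := h.ray_mem_resolventSet_conj hα hα1 hσ hr
  have hb := h.norm_rayResolvent_le (σ := -σ) hα hα1 (by rwa [abs_neg]) hr
  simp only [rayResolvent, ← conj_ray_cpow (hσ.trans_lt h.omega_lt) hr] at hb ⊢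
  exact ⟨(norm_resolventOp_transpose_le hmem).trans hb.1,
    (norm_resolventOp_transpose_comp_le hmem).trans hb.2⟩

theorem inner_rayResolvent_transpose (h : IsSectorialPair ι A As ω₀ c₀ c₁ M₀) {α σ r : ℝ}
    (hα : 0 < α) (hα1 : α ≤ 1) (hσ : |σ| ≤ ω₀) (hr : 0 < r) (f : AntiDual X) (y : Y) :
    ⟪y, rayResolvent (transpose ι) (transpose As) α σ r f⟫_ℂ
      = f (rayResolvent ι As α (-σ) r y) := by
  rw [rayResolvent, inner_resolventOp_transpose (h.ray_mem_resolventSet_conj hα hα1 hσ hr),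
    conj_ray_cpow (hσ.trans_lt h.omega_lt) hr, rayResolvent]

theorem continuousOn_forwardOp (h : IsSectorialPair ι A As ω₀ c₀ c₁ M₀) {α : ℝ}
    (hα : 0 < α) (hα1 : α ≤ 1) : ContinuousOn (forwardOp ι As ω₀ α) (Ioi 0) := by
  have hσ : |ω₀| ≤ ω₀ := (abs_of_pos h.omega_pos).le
  have hσ' : |-ω₀| ≤ ω₀ := by rwa [abs_neg]
  exact continuousOn_solutionOp h.cos_neg (h.continuousOn_rayResolvent_transpose hα hα1 hσ)
    (h.continuousOn_rayResolvent_transpose hα hα1 hσ')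
    (fun r hr => (h.norm_rayResolvent_transpose_le hα hα1 hσ hr).1)
    (fun r hr => (h.norm_rayResolvent_transpose_le hα hα1 hσ' hr).1)

theorem exists_norm_forwardOp_le (h : IsSectorialPair ι A As ω₀ c₀ c₁ M₀) {α : ℝ}
    (hα : 0 < α) (hα1 : α ≤ 1) :
    ∃ K, 0 ≤ K ∧ ∀ t, 0 < t → ‖forwardOp ι As ω₀ α t‖ ≤ K * t ^ (-1 : ℝ) := by
  have hσ : |ω₀| ≤ ω₀ := (abs_of_pos h.omega_pos).le
  have hσ' : |-ω₀| ≤ ω₀ := by rwa [abs_neg]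
  have hC : 0 ≤ (M₀ + 1) / c₀ := div_nonneg (by linarith [h.M₀_pos]) h.c₀_pos.le
  obtain ⟨K, hK, hb⟩ := exists_norm_sub_rayTransform_le (β := 0) h.cos_neg one_pos hC
    (k₁ := rayResolvent (transpose ι) (transpose As) α ω₀)
    (k₂ := rayResolvent (transpose ι) (transpose As) α (-ω₀))
    (fun r hr => by simpa using (h.norm_rayResolvent_transpose_le hα hα1 hσ hr).1)
    (fun r hr => by simpa using (h.norm_rayResolvent_transpose_le hα hα1 hσ' hr).1)
  refine ⟨K, hK, fun t ht => ?_⟩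
  rw [forwardOp, solutionOp_eq_rayTransform]
  rw [zero_sub] at hb
  exact hb t ht

/-- The optimal exponent is `α - 1`, but on this contour it is off by a logarithm if `α = 1`.  Any
exponent above `-1` will do. -/
theorem exists_norm_forwardOp_comp_le (h : IsSectorialPair ι A As ω₀ c₀ c₁ M₀) {α : ℝ}
    (hα : 0 < α) (hα1 : α ≤ 1) :
    ∃ K, 0 ≤ K ∧ ∀ t, 0 < t →
      ‖forwardOp ι As ω₀ α t ∘L transpose ι‖ ≤ K * t ^ (α / 2 - 1) := by
  have hσ : |ω₀| ≤ ω₀ := (abs_of_pos h.omega_pos).le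
  have hσ' : |-ω₀| ≤ ω₀ := by rwa [abs_neg]
  obtain ⟨K, hK, hb⟩ := exists_norm_sub_rayTransform_le (β := α / 2) h.cos_neg (by linarith)
    h.M₀_pos.le
    (k₁ := fun r => rayResolvent (transpose ι) (transpose As) α ω₀ r ∘L transpose ι)
    (k₂ := fun r => rayResolvent (transpose ι) (transpose As) α (-ω₀) r ∘L transpose ι)
    (fun r hr => (h.norm_rayResolvent_transpose_le hα hα1 hσ hr).2)
    (fun r hr => (h.norm_rayResolvent_transpose_le hα hα1 hσ' hr).2)
  refine ⟨K, hK, fun t ht => ?_⟩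
  let L : (AntiDual X →L[ℂ] Y) →L[ℂ] (Y →L[ℂ] Y) :=
    (ContinuousLinearMap.compL ℂ Y (AntiDual X) Y).flip (transpose ι)
  have e1 : L (rayTransform ω₀ (rayResolvent (transpose ι) (transpose As) α ω₀) t) = _ :=
    map_rayTransform (β := 0) L (h.continuousOn_rayResolvent_transpose hα hα1 hσ) h.cos_neg one_pos
      (fun r hr => by simpa using (h.norm_rayResolvent_transpose_le hα hα1 hσ hr).1) ht
  have e2 : L (rayTransform (-ω₀) (rayResolvent (transpose ι) (transpose As) α (-ω₀)) t) = _ :=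
    map_rayTransform (β := 0) L (h.continuousOn_rayResolvent_transpose hα hα1 hσ')
      (by rw [Real.cos_neg]; exact h.cos_neg) one_pos
      (fun r hr => by simpa using (h.norm_rayResolvent_transpose_le hα hα1 hσ' hr).1) ht
  have e : forwardOp ι As ω₀ α t ∘L transpose ι = L (forwardOp ι As ω₀ α t) := rfl
  rw [e, forwardOp, map_solutionOp, e1, e2]
  exact hb t ht

/-- The operator `E_α(t)` on `X^*` is the adjoint of `E_α^*(t)`: the contour is symmetric with
respect to the real axis. -/
theorem inner_forwardOp (h : IsSectorialPair ι A As ω₀ c₀ c₁ M₀) {α : ℝ}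
    (hα : 0 < α) (hα1 : α ≤ 1) {t : ℝ} (ht : 0 < t) (f : AntiDual X) (y : Y) :
    ⟪y, forwardOp ι As ω₀ α t f⟫_ℂ = f (backwardOp ι As ω₀ α t y) := by
  let Φ : (AntiDual X →L[ℂ] Y) →L[ℂ] ℂ :=
    innerSL ℂ y ∘L ContinuousLinearMap.apply ℂ Y f
  let Ψ : (Y →L[ℂ] X) →L[ℂ] ℂ :=
    (starL ℂ : ℂ ≃L⋆[ℂ] ℂ).toContinuousLinearMap.comp (f.comp (ContinuousLinearMap.apply ℂ X y))
  have hΨ : ∀ L, f (L y) = conj (Ψ L) := fun L => (Complex.conj_conj _).symm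
  have key : ∀ σ : ℝ, |σ| ≤ ω₀ → Real.cos σ < 0 →
      Φ (rayTransform σ (rayResolvent (transpose ι) (transpose As) α σ) t)
        = conj (Ψ (rayTransform (-σ) (rayResolvent ι As α (-σ)) t)) := by
    intro σ hσ hcos
    have hσ' : |-σ| ≤ ω₀ := by rwa [abs_neg]
    rw [map_rayTransform (β := 0) Φ (h.continuousOn_rayResolvent_transpose hα hα1 hσ) hcos one_pos
        (fun r hr => by simpa using (h.norm_rayResolvent_transpose_le hα hα1 hσ hr).1) ht,
      map_rayTransform (β := 0) Ψ (h.continuousOn_rayResolvent hα hα1 hσ')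
        (by rwa [Real.cos_neg]) one_pos
        (fun r hr => by simpa using (h.norm_rayResolvent_le hα hα1 hσ' hr).1) ht,
      conj_rayTransform, neg_neg]
    refine setIntegral_congr_fun measurableSet_Ioi fun r hr => ?_
    have : Φ (rayResolvent (transpose ι) (transpose As) α σ r)
        = conj (Ψ (rayResolvent ι As α (-σ) r)) := by
      rw [← hΨ]
      exact h.inner_rayResolvent_transpose hα hα1 hσ hr f y
    simp only [rayIntegrand, this]
  have hσ : |ω₀| ≤ ω₀ := (abs_of_pos h.omega_pos).le
  have hσ' : |-ω₀| ≤ ω₀ := by rwa [abs_neg]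
  have k1 := key ω₀ hσ h.cos_neg
  have k2 := key (-ω₀) hσ' (by rw [Real.cos_neg]; exact h.cos_neg)
  rw [neg_neg] at k2
  rw [hΨ]
  change Φ (forwardOp ι As ω₀ α t) = _
  rw [forwardOp, backwardOp, map_solutionOp, map_solutionOp, k1, k2]
  simp only [smul_eq_mul, map_mul, map_sub, map_inv₀, Complex.conj_I, Complex.conj_ofReal,
    map_ofNat]
  rw [mul_neg, inv_neg]
  ring

end IsSectorialPair

/-! ### Interpolation of operators -/

namespace Interp

variable {E₀ E₁ V G : Type*}
  [NormedAddCommGroup E₀] [NormedSpace ℂ E₀] [NormedAddCommGroup E₁] [NormedSpace ℂ E₁]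
  [NormedAddCommGroup V] [NormedSpace ℂ V] [NormedAddCommGroup G] [NormedSpace ℂ G]
  {i₀ : E₀ →L[ℂ] V} {i₁ : E₁ →L[ℂ] V} {θ : unitInterval}

/-- The inclusion `[E₀, E₁]_θ ⊂ E₀ + E₁` is continuous. -/
noncomputable def valL (i₀ : E₀ →L[ℂ] V) (i₁ : E₁ →L[ℂ] V) (θ : unitInterval) :
    Interp i₀ i₁ θ →L[ℂ] V :=
  val.mkContinuous _ norm_val_le

/-- The interpolation property, for operators into a single space. -/
theorem norm_map_val_le (S : V →L[ℂ] G) {C₀ C₁ : ℝ} (hC₀ : 0 ≤ C₀) (hC₁ : 0 ≤ C₁)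
    (h₀ : ‖S ∘L i₀‖ ≤ C₀) (h₁ : ‖S ∘L i₁‖ ≤ C₁) (a : Interp i₀ i₁ θ) :
    ‖S (val a)‖ ≤ C₀ ^ (1 - (θ : ℝ)) * C₁ ^ (θ : ℝ) * ‖a‖ := by
  have hθ0 : (0 : ℝ) ≤ θ := θ.2.1
  have hθ1 : (0 : ℝ) ≤ 1 - θ := sub_nonneg.2 θ.2.2
  set D : ℝ := C₀ ^ (1 - (θ : ℝ)) * C₁ ^ (θ : ℝ) with hD
  have hD0 : 0 ≤ D := by positivity
  have key : ∀ r ∈ normSet a, ‖S (val a)‖ ≤ D * r := by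
    rintro _ ⟨f, g₀, g₁, h, ha, rfl⟩
    set m := max ‖g₀‖ ‖g₁‖ with hm
    have hm0 : 0 ≤ m := le_max_of_le_left (norm_nonneg _)
    obtain ⟨C, hC⟩ := h.bdd
    have main := Complex.HadamardThreeLines.norm_le_interp_of_mem_verticalClosedStrip₀₁'
      (fun z => S (f z)) (z := ((θ : ℝ) : ℂ)) (a := C₀ * m) (b := C₁ * m)
      ⟨by simpa using hθ0, by simpa using θ.2.2⟩
      ⟨S.differentiable.comp_differentiableOn h.holo.differentiableOn,
        S.continuous.comp_continuousOn h.holo.continuousOn⟩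
      ⟨‖S‖ * C, by
        rintro _ ⟨z, hz, rfl⟩
        exact (S.le_opNorm _).trans (by gcongr; exact hC z hz)⟩
      (fun z hz => by
        have hz : z.re = 0 := hz
        have : z = (z.im : ℂ) * I := by apply Complex.ext <;> simp [hz]
        rw [this, h.left]
        refine ((S ∘L i₀).le_opNorm _).trans ?_
        gcongr
        exact (g₀.norm_coe_le_norm _).trans (le_max_left _ _))
      (fun z hz => by
        have hz : z.re = 1 := hz
        have : z = 1 + (z.im : ℂ) * I := by apply Complex.ext <;> simp [hz]
        rw [this, h.right]
        refine ((S ∘L i₁).le_opNorm _).trans ?_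
        gcongr
        exact (g₁.norm_coe_le_norm _).trans (le_max_right _ _))
    rw [← ha]
    refine main.trans (le_of_eq ?_)
    rw [Complex.ofReal_re, Real.mul_rpow hC₀ hm0, Real.mul_rpow hC₁ hm0, hD]
    have : m ^ (1 - (θ : ℝ)) * m ^ (θ : ℝ) = m := by
      rw [← Real.rpow_add_of_nonneg hm0 hθ1 hθ0]; simp
    linear_combination (C₀ ^ (1 - (θ : ℝ)) * C₁ ^ (θ : ℝ)) * this
  rcases hD0.eq_or_lt with h0 | hpos
  · obtain ⟨r, hr⟩ := normSet_nonempty a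
    have := key r hr
    rw [← h0] at this ⊢
    simpa using this
  · rw [mul_comm, ← div_le_iff₀ hpos]
    exact le_csInf (normSet_nonempty a) fun r hr => (div_le_iff₀' hpos).2 (key r hr)

end Interp

/-- On `[X^*, Y]_θ` the operator `E_α(t)` has, for `θ > 0`, a singularity at `t = 0` that is
integrable. -/
theorem IsSectorialPair.exists_norm_forwardOp_val_le {X Y : Type*} [NormedAddCommGroup X]
    [InnerProductSpace ℂ X] [CompleteSpace X] [NormedAddCommGroup Y] [InnerProductSpace ℂ Y]
    [CompleteSpace Y] {ι A As : X →L[ℂ] Y} {ω₀ c₀ c₁ M₀ : ℝ}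
    (h : IsSectorialPair ι A As ω₀ c₀ c₁ M₀) {α : ℝ} (hα : 0 < α) (hα1 : α ≤ 1)
    (θ : unitInterval) :
    ∃ K, 0 ≤ K ∧ ∀ t, 0 < t → ∀ a : InterpNeg ι θ,
      ‖forwardOp ι As ω₀ α t (Interp.val a)‖ ≤ K * t ^ (α / 2 * θ - 1) * ‖a‖ := by
  obtain ⟨K₀, hK₀, h₀⟩ := h.exists_norm_forwardOp_le hα hα1
  obtain ⟨K₁, hK₁, h₁⟩ := h.exists_norm_forwardOp_comp_le hα hα1
  refine ⟨K₀ ^ (1 - (θ : ℝ)) * K₁ ^ (θ : ℝ), by positivity, fun t ht a => ?_⟩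
  refine (Interp.norm_map_val_le (C₀ := K₀ * t ^ (-1 : ℝ))
    (forwardOp ι As ω₀ α t) (by positivity) (by positivity)
    (by rw [ContinuousLinearMap.comp_id]; exact h₀ t ht) (h₁ t ht) a).trans (le_of_eq ?_)
  rw [Real.mul_rpow hK₀ (by positivity), Real.mul_rpow hK₁ (by positivity), ← Real.rpow_mul ht.le,
    ← Real.rpow_mul ht.le]
  have : t ^ (-1 * (1 - (θ : ℝ))) * t ^ ((α / 2 - 1) * (θ : ℝ)) = t ^ (α / 2 * θ - 1) := by
    rw [← Real.rpow_add ht]; congr 1; ring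
  rw [← this]
  ring

/-! ### Integral operators on bounded subsets of `L^∞` -/

section IntegralOperator

variable {Ω Y Z : Type*} [MeasurableSpace Ω] {μ : Measure Ω}
  [NormedAddCommGroup Y] [NormedSpace ℂ Y] [NormedAddCommGroup Z]

theorem exists_seq_tendsto_ae_of_tendsto_Lp {u : ℕ → Lp Z 2 μ} {v : Lp Z 2 μ}
    (h : Tendsto u atTop (𝓝 v)) :
    ∃ ns : ℕ → ℕ, StrictMono ns ∧
      ∀ᵐ s ∂μ, Tendsto (fun n => u (ns n) s) atTop (𝓝 (v s)) :=
  (tendstoInMeasure_of_tendsto_Lp h).exists_seq_tendsto_ae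

theorem isClosed_setOf_ae_norm_le (N : ℝ) :
    IsClosed {u : Lp Z 2 μ | ∀ᵐ s ∂μ, ‖u s‖ ≤ N} := by
  refine IsSeqClosed.isClosed fun u v hu hv => ?_
  obtain ⟨ns, -, hae⟩ := exists_seq_tendsto_ae_of_tendsto_Lp hv
  filter_upwards [hae, ae_all_iff.2 fun n => hu (ns n)] with s h1 h2
  exact le_of_tendsto' h1.norm h2

variable [NormedSpace ℂ Z] {k : Ω → Z →L[ℂ] Y}

theorem aestronglyMeasurable_clm_apply {u : Ω → Z} (hk : AEStronglyMeasurable k μ)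
    (hu : AEStronglyMeasurable u μ) : AEStronglyMeasurable (fun s => k s (u s)) μ :=
  isBoundedBilinearMap_apply.continuous.comp_aestronglyMeasurable (hk.prodMk hu)

theorem norm_clm_apply_le_of_ae {u : Ω → Z} {N : ℝ} (hN : ∀ᵐ s ∂μ, ‖u s‖ ≤ N) :
    ∀ᵐ s ∂μ, ‖k s (u s)‖ ≤ ‖k s‖ * N := by
  filter_upwards [hN] with s hs
  exact (k s).le_opNorm_of_le hs

theorem integrable_clm_apply {u : Ω → Z} {N : ℝ} (hk : Integrable k μ)
    (hu : AEStronglyMeasurable u μ) (hN : ∀ᵐ s ∂μ, ‖u s‖ ≤ N) :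
    Integrable (fun s => k s (u s)) μ :=
  Integrable.mono' (hk.norm.mul_const N) (aestronglyMeasurable_clm_apply hk.1 hu)
    (norm_clm_apply_le_of_ae hN)

/-- The operator `u ↦ ∫ k u` is in general not defined on `L²`, but it is continuous for the norm of
`L²` on the bounded subsets of `L^∞`, by dominated convergence. -/
theorem continuousOn_integral_clm_apply (hk : Integrable k μ) (N : ℝ) :
    ContinuousOn (fun u : Lp Z 2 μ => ∫ s, k s (u s) ∂μ) {u | ∀ᵐ s ∂μ, ‖u s‖ ≤ N} := by
  intro v _
  refine tendsto_of_subseq_tendsto fun w hw => ?_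
  obtain ⟨hw1, hw2⟩ := tendsto_nhdsWithin_iff.1 hw
  obtain ⟨n₀, hn₀⟩ := eventually_atTop.1 hw2
  obtain ⟨ns, hns, hae⟩ :=
    exists_seq_tendsto_ae_of_tendsto_Lp ((tendsto_add_atTop_iff_nat n₀).2 hw1)
  refine ⟨fun n => ns n + n₀, ?_⟩
  refine tendsto_integral_of_dominated_convergence (fun s => ‖k s‖ * N)
    (fun n => aestronglyMeasurable_clm_apply hk.1 (Lp.aestronglyMeasurable _))
    (hk.norm.mul_const N)
    (fun n => norm_clm_apply_le_of_ae (hn₀ _ (Nat.le_add_left _ _))) ?_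
  filter_upwards [hae] with s hs
  exact ((k s).continuous.tendsto _).comp hs

/-- A bounded closed convex subset of `L²` all of whose elements are in `L^∞` is bounded in `L^∞`.
By Baire's theorem the sets of its elements of `L^∞`-norm at most `n` cannot all be nowhere dense
in it, and convexity moves a bound near one point to the whole set. -/
theorem exists_ae_norm_le_of_forall_memLp_top [CompleteSpace Z] {U : Set (Lp Z 2 μ)}
    (hne : U.Nonempty) (hconv : Convex ℝ U) (hbdd : Bornology.IsBounded U) (hcl : IsClosed U)
    (htop : ∀ u ∈ U, MemLp u ⊤ μ) : ∃ N : ℝ, ∀ u ∈ U, ∀ᵐ s ∂μ, ‖u s‖ ≤ N := by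
  have : CompleteSpace U := hcl.completeSpace_coe
  have : Nonempty U := hne.to_subtype
  let F : ℕ → Set U := fun n => {u | ∀ᵐ s ∂μ, ‖(u : Lp Z 2 μ) s‖ ≤ n}
  have hF : ∀ n, IsClosed (F n) := fun n =>
    (isClosed_setOf_ae_norm_le (n : ℝ)).preimage continuous_subtype_val
  have hcover : ⋃ n, F n = univ := by
    refine eq_univ_of_forall fun u => mem_iUnion.2 ?_
    have hu : eLpNormEssSup (u : Lp Z 2 μ) μ < ⊤ := by
      simpa using (htop u u.2).2
    obtain ⟨n, hn⟩ := exists_nat_ge (eLpNormEssSup (u : Lp Z 2 μ) μ).toReal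
    refine ⟨n, ?_⟩
    filter_upwards [ae_le_eLpNormEssSup (f := (u : Lp Z 2 μ)) (μ := μ)] with s hs
    refine le_trans ?_ hn
    simpa using ENNReal.toReal_mono hu.ne hs
  obtain ⟨n, u₀, hu₀⟩ := nonempty_interior_of_iUnion_of_closed hF hcover
  obtain ⟨ε, hε, hball⟩ := Metric.isOpen_iff.1 isOpen_interior u₀ hu₀
  obtain ⟨D, hD0, hD⟩ : ∃ D : ℝ, 0 < D ∧ ∀ u ∈ U, ‖u - (u₀ : Lp Z 2 μ)‖ < D := by
    obtain ⟨D, hD⟩ := hbdd.subset_ball (u₀ : Lp Z 2 μ)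
    refine ⟨max D 1, by positivity, fun u hu => ?_⟩
    have := hD hu
    rw [Metric.mem_ball, dist_eq_norm] at this
    exact this.trans_le (le_max_left _ _)
  -- Going from `u₀` the fraction `l` of the way to any point of `U` stays in the ball of radius `ε`.
  set l : ℝ := min 1 (ε / D) with hl
  have hl0 : 0 < l := lt_min one_pos (by positivity)
  refine ⟨n + 2 * n / l, fun u hu => ?_⟩
  have hw : (u₀ : Lp Z 2 μ) + l • (u - (u₀ : Lp Z 2 μ)) ∈ U :=
    hconv.add_smul_sub_mem u₀.2 hu ⟨hl0.le, min_le_left _ _⟩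
  have hwF : (⟨_, hw⟩ : U) ∈ F n := by
    refine interior_subset (hball ?_)
    rw [Metric.mem_ball, Subtype.dist_eq, dist_eq_norm, add_sub_cancel_left, norm_smul,
      Real.norm_of_nonneg hl0.le]
    calc l * ‖u - (u₀ : Lp Z 2 μ)‖ < l * D := by gcongr; exact hD u hu
      _ ≤ ε / D * D := by gcongr; exact min_le_right _ _
      _ = ε := by field_simp
  have hu₀F : u₀ ∈ F n := interior_subset hu₀
  filter_upwards [hwF, hu₀F, Lp.coeFn_add (u₀ : Lp Z 2 μ) (l • (u - (u₀ : Lp Z 2 μ))),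
    Lp.coeFn_smul l (u - (u₀ : Lp Z 2 μ)), Lp.coeFn_sub u (u₀ : Lp Z 2 μ)] with s h1 h2 h3 h4 h5
  simp only [Pi.add_apply, Pi.smul_apply, Pi.sub_apply] at h3 h4 h5
  rw [h3, h4, h5] at h1
  have h6 : l * ‖u s - (u₀ : Lp Z 2 μ) s‖ ≤ 2 * n := by
    have := norm_sub_le ((u₀ : Lp Z 2 μ) s + l • (u s - (u₀ : Lp Z 2 μ) s)) ((u₀ : Lp Z 2 μ) s)
    rw [add_sub_cancel_left, norm_smul, Real.norm_of_nonneg hl0.le] at this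
    linarith
  have h7 : ‖u s - (u₀ : Lp Z 2 μ) s‖ ≤ 2 * n / l := by
    rwa [le_div_iff₀' hl0]
  have := norm_add_le ((u₀ : Lp Z 2 μ) s) (u s - (u₀ : Lp Z 2 μ) s)
  rw [add_sub_cancel] at this
  linarith

/-- The real scalar multiplication of `L²` comes from that of `Z`, not from the complex scalar
multiplication of `L²`; the two agree. -/
theorem Lp_ofReal_smul (a : ℝ) (u : Lp Z 2 μ) : (a : ℂ) • u = a • u := by
  refine Lp.ext ?_
  filter_upwards [Lp.coeFn_smul a u, Lp.coeFn_smul (a : ℂ) u] with s h1 h2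
  rw [h1, h2, Pi.smul_apply, Pi.smul_apply]
  rfl

theorem integral_clm_apply_smul_add_smul {u v : Lp Z 2 μ} (hu : Integrable (fun s => k s (u s)) μ)
    (hv : Integrable (fun s => k s (v s)) μ) (a b : ℝ) :
    ∫ s, k s (((a : ℂ) • u + (b : ℂ) • v : Lp Z 2 μ) s) ∂μ =
      a • ∫ s, k s (u s) ∂μ + b • ∫ s, k s (v s) ∂μ := by
  have hu' : Integrable (fun s => a • k s (u s)) μ := hu.smul a
  have hv' : Integrable (fun s => b • k s (v s)) μ := hv.smul b
  rw [← integral_smul, ← integral_smul, ← integral_add hu' hv']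
  refine integral_congr_ae ?_
  filter_upwards [Lp.coeFn_add ((a : ℂ) • u) ((b : ℂ) • v), Lp.coeFn_smul (a : ℂ) u,
    Lp.coeFn_smul (b : ℂ) v]
    with s h1 h2 h3
  rw [h1, Pi.add_apply, h2, h3, map_add, Pi.smul_apply, Pi.smul_apply, map_smul, map_smul]
  rfl

end IntegralOperator

section Adjoint

variable {Ω Y Z : Type*} [MeasurableSpace Ω] {μ : Measure Ω}
  [NormedAddCommGroup Y] [InnerProductSpace ℂ Y] [CompleteSpace Y]
  [NormedAddCommGroup Z] [InnerProductSpace ℂ Z] {k : Ω → Z →L[ℂ] Y}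

/-- If `p s = (k s)^* q`, then the pairing of `v - u` with `p + ν u` in `L²` is the sum of that of
`∫ k (v - u)` with `q` and of `ν (v - u, u)`.  The function `p` need not be in `L²`. -/
theorem integrable_and_integral_inner_adjoint {p : Ω → Z} {q : Y}
    (hp : ∀ᵐ s ∂μ, ∀ z, ⟪z, p s⟫_ℂ = ⟪k s z, q⟫_ℂ) {u v : Lp Z 2 μ}
    (hu : Integrable (fun s => k s (u s)) μ) (hv : Integrable (fun s => k s (v s)) μ) (ν : ℂ) :
    Integrable (fun s => ⟪v s - u s, p s + ν • u s⟫_ℂ) μ ∧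
      ∫ s, ⟪v s - u s, p s + ν • u s⟫_ℂ ∂μ =
        ⟪∫ s, k s (v s) ∂μ - ∫ s, k s (u s) ∂μ, q⟫_ℂ + ν * ⟪v - u, u⟫_ℂ := by
  have heq : (fun s => ⟪k s (v s) - k s (u s), q⟫_ℂ + ν * ⟪(v - u : Lp Z 2 μ) s, u s⟫_ℂ) =ᵐ[μ]
      fun s => ⟪v s - u s, p s + ν • u s⟫_ℂ := by
    filter_upwards [hp, Lp.coeFn_sub v u] with s h1 h2
    rw [inner_add_right, inner_smul_right, h1, map_sub, h2, Pi.sub_apply]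
  have hvu : Integrable (fun s => k s (v s) - k s (u s)) μ := hv.sub hu
  have hi1 : Integrable (fun s => ⟪k s (v s) - k s (u s), q⟫_ℂ) μ := hvu.inner_const q
  have hi2 : Integrable (fun s => ν * ⟪(v - u : Lp Z 2 μ) s, u s⟫_ℂ) μ :=
    (L2.integrable_inner (𝕜 := ℂ) (v - u) u).const_mul _
  refine ⟨(hi1.add hi2).congr heq, ?_⟩
  rw [← integral_congr_ae heq, integral_add hi1 hi2, integral_const_mul, ← L2.inner_def]
  congr 1
  rw [← inner_conj_symm, ← integral_sub hv hu, ← integral_inner hvu, ← integral_conj]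
  simp only [inner_conj_symm]

end Adjoint

/-! ### Quadratic minimization over a convex set -/

/-- The minimizer is the projection of the origin to the graph of `u ↦ (S u - y, √ν u)` over `K`,
which is closed and convex; the inequality is the one that characterizes the projection. -/
theorem exists_minimizer_of_convex {Y H : Type*} [NormedAddCommGroup Y] [InnerProductSpace ℝ Y]
    [CompleteSpace Y] [NormedAddCommGroup H] [InnerProductSpace ℝ H] [CompleteSpace H]
    {K : Set H} (hne : K.Nonempty) (hconv : Convex ℝ K) (hcl : IsClosed K) {S : H → Y}
    (hS : ContinuousOn S K)
    (hadd : ∀ u ∈ K, ∀ v ∈ K, ∀ a b : ℝ, 0 ≤ a → 0 ≤ b → a + b = 1 →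
      S (a • u + b • v) = a • S u + b • S v)
    (y : Y) {ν : ℝ} (hν : 0 < ν) :
    ∃ u ∈ K, IsMinOn (fun u => 1 / 2 * ‖S u - y‖ ^ 2 + ν / 2 * ‖u‖ ^ 2) K u ∧
      (∀ u' ∈ K, IsMinOn (fun u => 1 / 2 * ‖S u - y‖ ^ 2 + ν / 2 * ‖u‖ ^ 2) K u' → u' = u) ∧
      ∀ v ∈ K, 0 ≤ inner ℝ (S v - S u) (S u - y) + ν * inner ℝ (v - u) u := by
  set m : ℝ := √ν with hm
  have hm0 : 0 < m := Real.sqrt_pos.2 hν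
  have hmm : m * m = ν := Real.mul_self_sqrt hν.le
  let Φ : H → WithLp 2 (Y × H) := fun u => WithLp.toLp 2 (S u - y, m • u)
  have hΦinner : ∀ u v, inner ℝ (Φ u) (Φ v - Φ u) =
      inner ℝ (S v - S u) (S u - y) + ν * inner ℝ (v - u) u := by
    intro u v
    rw [WithLp.prod_inner_apply]
    change inner ℝ (S u - y) (S v - y - (S u - y)) + inner ℝ (m • u) (m • v - m • u) = _
    rw [sub_sub_sub_cancel_right, ← smul_sub, inner_smul_left, inner_smul_right, real_inner_comm,
      real_inner_comm (v - u), ← mul_assoc, ← hmm]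
    rfl
  have hJ : ∀ u, 1 / 2 * ‖S u - y‖ ^ 2 + ν / 2 * ‖u‖ ^ 2 = 1 / 2 * ‖Φ u‖ ^ 2 := by
    intro u
    rw [WithLp.prod_norm_sq_eq_of_L2]
    change _ = 1 / 2 * (‖S u - y‖ ^ 2 + ‖m • u‖ ^ 2)
    rw [norm_smul, Real.norm_of_nonneg hm0.le, ← hmm]
    ring
  have hGconv : Convex ℝ (Φ '' K) := by
    rintro _ ⟨u, hu, rfl⟩ _ ⟨v, hv, rfl⟩ a b ha hb hab
    refine ⟨a • u + b • v, hconv hu hv ha hb hab, ?_⟩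
    refine (WithLp.equiv 2 _).injective (Prod.ext ?_ ?_)
    · change S (a • u + b • v) - y = a • (S u - y) + b • (S v - y)
      rw [hadd u hu v hv a b ha hb hab, smul_sub, smul_sub]
      have : y = a • y + b • y := by rw [← add_smul, hab, one_smul]
      nth_rewrite 1 [this]
      abel
    · change m • (a • u + b • v) = a • m • u + b • m • v
      rw [smul_add, smul_comm m a, smul_comm m b]
  have hGcl : IsClosed (Φ '' K) := by
    refine IsSeqClosed.isClosed fun p q hp hq => ?_
    choose u hu hup using hp
    have h1 : Tendsto (fun n => (p n).fst) atTop (𝓝 q.fst) :=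
      ((WithLp.prod_continuous_ofLp 2 Y H).fst.tendsto q).comp hq
    have h2 : Tendsto (fun n => (p n).snd) atTop (𝓝 q.snd) :=
      ((WithLp.prod_continuous_ofLp 2 Y H).snd.tendsto q).comp hq
    have h3 : Tendsto u atTop (𝓝 (m⁻¹ • q.snd)) := by
      refine (h2.const_smul m⁻¹).congr fun n => ?_
      rw [← hup]
      exact inv_smul_smul₀ hm0.ne' (u n)
    have h4 : m⁻¹ • q.snd ∈ K := hcl.mem_of_tendsto h3 (Eventually.of_forall hu)
    have h5 : Tendsto (fun n => S (u n) - y) atTop (𝓝 (S (m⁻¹ • q.snd) - y)) :=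
      ((hS _ h4).tendsto.comp (tendsto_nhdsWithin_iff.2 ⟨h3, Eventually.of_forall hu⟩)).sub_const y
    have h6 : S (m⁻¹ • q.snd) - y = q.fst := by
      refine tendsto_nhds_unique h5 (h1.congr fun n => ?_)
      rw [← hup]
      rfl
    refine ⟨m⁻¹ • q.snd, h4, (WithLp.equiv 2 _).injective (Prod.ext h6 ?_)⟩
    exact smul_inv_smul₀ hm0.ne' q.snd
  obtain ⟨_, ⟨u, hu, rfl⟩, hproj⟩ :=
    exists_norm_eq_iInf_of_complete_convex (hne.image Φ) hGcl.isComplete hGconv 0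
  have hvar : ∀ v ∈ K, 0 ≤ inner ℝ (Φ u) (Φ v - Φ u) := by
    intro v hv
    have := (norm_eq_iInf_iff_real_inner_le_zero hGconv (mem_image_of_mem Φ hu)).1 hproj _
      (mem_image_of_mem Φ hv)
    rw [zero_sub, inner_neg_left] at this
    linarith
  have hquad : ∀ v ∈ K, ‖Φ u‖ ^ 2 + ‖Φ v - Φ u‖ ^ 2 ≤ ‖Φ v‖ ^ 2 := by
    intro v hv
    have := norm_add_sq_real (Φ u) (Φ v - Φ u)
    rw [add_sub_cancel] at this
    have := hvar v hv
    linarith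
  refine ⟨u, hu, fun v hv => ?_, fun u' hu' hmin => ?_, fun v hv => ?_⟩
  · have := hquad v hv
    refine (hJ u).trans_le (le_trans ?_ (hJ v).ge)
    nlinarith [sq_nonneg ‖Φ v - Φ u‖]
  · have h1 := (hJ u').ge.trans ((isMinOn_iff.1 hmin u hu).trans_eq (hJ u))
    have h2 := hquad u' hu'
    have h3 : ‖Φ u' - Φ u‖ ^ 2 ≤ 0 := by linarith
    have h4 : Φ u' - Φ u = 0 := norm_eq_zero.1 (pow_eq_zero_iff two_ne_zero |>.1
      (le_antisymm h3 (sq_nonneg _)))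
    have h5 : m • u' = m • u := congrArg (fun p : WithLp 2 (Y × H) => p.snd) (sub_eq_zero.1 h4)
    exact smul_right_injective H hm0.ne' h5
  · rw [← hΦinner]
    exact hvar v hv

/-- The case of complex spaces, with convexity in terms of the complex scalar multiplication. -/
theorem exists_minimizer_of_convex_complex {Y H : Type*} [NormedAddCommGroup Y]
    [InnerProductSpace ℂ Y] [CompleteSpace Y] [NormedAddCommGroup H] [InnerProductSpace ℂ H]
    [CompleteSpace H] {K : Set H} (hne : K.Nonempty)
    (hconv : ∀ u ∈ K, ∀ v ∈ K, ∀ a b : ℝ, 0 ≤ a → 0 ≤ b → a + b = 1 →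
      (a : ℂ) • u + (b : ℂ) • v ∈ K)
    (hcl : IsClosed K) {S : H → Y} (hS : ContinuousOn S K)
    (hadd : ∀ u ∈ K, ∀ v ∈ K, ∀ a b : ℝ, 0 ≤ a → 0 ≤ b → a + b = 1 →
      S ((a : ℂ) • u + (b : ℂ) • v) = a • S u + b • S v)
    (y : Y) {ν : ℝ} (hν : 0 < ν) :
    ∃ u ∈ K, IsMinOn (fun u => 1 / 2 * ‖S u - y‖ ^ 2 + ν / 2 * ‖u‖ ^ 2) K u ∧
      (∀ u' ∈ K, IsMinOn (fun u => 1 / 2 * ‖S u - y‖ ^ 2 + ν / 2 * ‖u‖ ^ 2) K u' → u' = u) ∧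
      ∀ v ∈ K, 0 ≤ (⟪S v - S u, S u - y⟫_ℂ + ν * ⟪v - u, u⟫_ℂ).re := by
  let _ : InnerProductSpace ℝ Y := InnerProductSpace.rclikeToReal ℂ Y
  let _ : InnerProductSpace ℝ H := InnerProductSpace.rclikeToReal ℂ H
  obtain ⟨u, hu, hmin, huniq, hvar⟩ := exists_minimizer_of_convex hne
    (fun u hu v hv a b => hconv u hu v hv a b) hcl hS hadd y hν
  refine ⟨u, hu, hmin, huniq, fun v hv => ?_⟩
  rw [Complex.add_re, Complex.re_ofReal_mul]
  exact hvar v hv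

/-! ### The state and its adjoint -/

section State

variable {X Y Z : Type*} [NormedAddCommGroup X] [InnerProductSpace ℂ X]
  [NormedAddCommGroup Y] [InnerProductSpace ℂ Y]
  [NormedAddCommGroup Z] [InnerProductSpace ℂ Z]

/-- The operator `E_α(t - s) R : Z → Y`. -/
noncomputable def stateKernel {ι : X →L[ℂ] Y} (As : X →L[ℂ] Y) (ω₀ α : ℝ) {θ : unitInterval}
    (R : Z →L[ℂ] InterpNeg ι θ) (t s : ℝ) : Z →L[ℂ] Y :=
  forwardOp ι As ω₀ α (t - s) ∘L (Interp.valL _ _ θ ∘L R)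

theorem integrableOn_sub_rpow {a : ℝ} (ha : 0 < a) {t : ℝ} (ht : 0 ≤ t) :
    IntegrableOn (fun s : ℝ => (t - s) ^ (a - 1)) (Ioo 0 t) := by
  have h := (intervalIntegral.intervalIntegrable_rpow' (a := t) (b := 0) (r := a - 1)
    (by linarith)).comp_sub_left t
  rw [sub_self, sub_zero, intervalIntegrable_iff_integrableOn_Ioc_of_le ht] at h
  exact h.mono_set Ioo_subset_Ioc_self

theorem state_eq_setIntegral {ι : X →L[ℂ] Y} (As : X →L[ℂ] Y) (ω₀ α : ℝ) {θ : unitInterval}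
    (R : Z →L[ℂ] InterpNeg ι θ) (u : ℝ → Z) {t : ℝ} (ht : 0 ≤ t) :
    state As ω₀ α R u t = ∫ s in Ioo 0 t, stateKernel As ω₀ α R t s (u s) := by
  rw [state, intervalIntegral.integral_of_le ht, integral_Ioc_eq_integral_Ioo]
  rfl

variable [CompleteSpace X] [CompleteSpace Y] {ι A As : X →L[ℂ] Y} {ω₀ c₀ c₁ M₀ : ℝ}

theorem IsSectorialPair.integrableOn_stateKernel (h : IsSectorialPair ι A As ω₀ c₀ c₁ M₀) {α : ℝ}
    (hα : 0 < α) (hα1 : α ≤ 1) {θ : unitInterval} (hθ : 0 < θ) (R : Z →L[ℂ] InterpNeg ι θ)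
    {t : ℝ} (ht : 0 ≤ t) : IntegrableOn (stateKernel As ω₀ α R t) (Ioo 0 t) := by
  obtain ⟨K, hK, hb⟩ := h.exists_norm_forwardOp_val_le hα hα1 θ
  have hθ' : (0 : ℝ) < θ := hθ
  have hint := (integrableOn_sub_rpow (a := α / 2 * θ) (by positivity) ht).const_mul (K * ‖R‖)
  refine Integrable.mono' hint ?_ ?_
  · refine ContinuousOn.aestronglyMeasurable ?_ measurableSet_Ioo
    refine ContinuousOn.clm_comp ?_ continuousOn_const
    exact (h.continuousOn_forwardOp hα hα1).comp (by fun_prop) fun s hs => sub_pos.2 hs.2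
  · filter_upwards [ae_restrict_mem measurableSet_Ioo] with s hs
    have hpos : 0 < t - s := sub_pos.2 hs.2
    refine ContinuousLinearMap.opNorm_le_bound _ (by positivity) fun z => ?_
    refine (hb (t - s) hpos (R z)).trans ?_
    calc K * (t - s) ^ (α / 2 * θ - 1) * ‖R z‖
        ≤ K * (t - s) ^ (α / 2 * θ - 1) * (‖R‖ * ‖z‖) := by gcongr; exact R.le_opNorm z
      _ = _ := by ring

/-- The duality of the state and the adjoint state, pointwise in time. -/
theorem IsSectorialPair.inner_rStar_adjointState [CompleteSpace Z]
    (h : IsSectorialPair ι A As ω₀ c₀ c₁ M₀) (hι : Function.Injective ι) {α : ℝ}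
    (hα : 0 < α) (hα1 : α ≤ 1) {θ : unitInterval} (R : Z →L[ℂ] InterpNeg ι θ)
    {T s : ℝ} (hs : s < T) (q : Y) (w : Z) :
    ⟪w, rStar R (adjointState ι As ω₀ α T θ q s)⟫_ℂ = ⟪stateKernel As ω₀ α R T s w, q⟫_ℂ := by
  rw [adjointState, inner_rStar_inclPos hι, ← h.inner_forwardOp hα hα1 (sub_pos.2 hs),
    inner_conj_symm]
  rfl

end State

end FracControl

theorem mainTheorem3
    {X Y Z : Type*}
    [NormedAddCommGroup X] [InnerProductSpace ℂ X] [CompleteSpace X]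
    [TopologicalSpace.SeparableSpace X]
    [NormedAddCommGroup Y] [InnerProductSpace ℂ Y] [CompleteSpace Y]
    [TopologicalSpace.SeparableSpace Y]
    [NormedAddCommGroup Z] [InnerProductSpace ℂ Z] [CompleteSpace Z]
    (ι : X →L[ℂ] Y) (hι_inj : Function.Injective ι) (hι_dense : DenseRange ι)
    (A As : X →L[ℂ] Y) (ω₀ c₀ c₁ M₀ : ℝ)
    (hA : FracControl.IsSectorialPair ι A As ω₀ c₀ c₁ M₀)
    (α T ν : ℝ) (hα_pos : 0 < α) (hα_le : α ≤ 1) (hT : 0 < T) (hν : 0 < ν)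
    (θ₀ : unitInterval) (hθ₀ : 0 < θ₀)
    (R : Z →L[ℂ] FracControl.InterpNeg ι θ₀) (yd : Y)
    (Uad : Set (FracControl.ControlSpace Z T))
    (hU_nonempty : Uad.Nonempty) (hU_convex : Convex ℝ Uad)
    (hU_bounded : Bornology.IsBounded Uad) (hU_closed : IsClosed Uad)
    (hU_Linfty : ∀ u ∈ Uad, MemLp u ⊤ (volume.restrict (Ioo (0 : ℝ) T))) :
    (∀ u ∈ Uad, ∀ t ∈ Icc (0 : ℝ) T,
      IntervalIntegrable (FracControl.stateIntegrand As ω₀ α R u t) volume 0 t) ∧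
    ∃ u ∈ Uad,
      IsMinOn (FracControl.cost As ω₀ α T R yd ν) Uad u ∧
      (∀ u' ∈ Uad, IsMinOn (FracControl.cost As ω₀ α T R yd ν) Uad u' → u' = u) ∧
      ∃ (y : ℝ → Y) (p : ℝ → FracControl.InterpPos ι θ₀),
        (∀ t ∈ Icc (0 : ℝ) T, y t = FracControl.state As ω₀ α R u t) ∧
        (∀ t ∈ Ioo (0 : ℝ) T,
          p t = FracControl.adjointState ι As ω₀ α T θ₀ (y T - yd) t) ∧
        ∀ v ∈ Uad,
          IntegrableOn
            (fun t => inner ℂ (v t - u t) (FracControl.rStar R (p t) + (ν : ℂ) • u t))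
            (Ioo 0 T) ∧
          0 ≤ (∫ t in Ioo (0 : ℝ) T,
            inner ℂ (v t - u t) (FracControl.rStar R (p t) + (ν : ℂ) • u t)).re := by
  set μ : Measure ℝ := volume.restrict (Ioo (0 : ℝ) T) with hμ
  set k : ℝ → Z →L[ℂ] Y := FracControl.stateKernel As ω₀ α R T with hk_def
  have hk : Integrable k μ := hA.integrableOn_stateKernel hα_pos hα_le hθ₀ R hT.le
  obtain ⟨N, hN⟩ := FracControl.exists_ae_norm_le_of_forall_memLp_top hU_nonempty hU_convex
    hU_bounded hU_closed hU_Linfty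
  have hint : ∀ u ∈ Uad, Integrable (fun s => k s (u s)) μ := fun u hu =>
    FracControl.integrable_clm_apply hk (Lp.aestronglyMeasurable u) (hN u hu)
  set S : FracControl.ControlSpace Z T → Y := fun u => ∫ s, k s (u s) ∂μ with hS_def
  have hstate : ∀ u : FracControl.ControlSpace Z T, FracControl.state As ω₀ α R u T = S u :=
    fun u => FracControl.state_eq_setIntegral As ω₀ α R u hT.le
  have hScont : ContinuousOn S Uad :=
    (FracControl.continuousOn_integral_clm_apply hk N).mono hN
  have hSadd : ∀ u ∈ Uad, ∀ v ∈ Uad, ∀ a b : ℝ, 0 ≤ a → 0 ≤ b → a + b = 1 →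
      S ((a : ℂ) • u + (b : ℂ) • v) = a • S u + b • S v := by
    intro u hu v hv a b _ _ _
    exact FracControl.integral_clm_apply_smul_add_smul (hint u hu) (hint v hv) a b
  obtain ⟨u, hu, hmin, huniq, hvar⟩ := FracControl.exists_minimizer_of_convex_complex hU_nonempty
    (fun u hu v hv a b ha hb hab => by
      rw [FracControl.Lp_ofReal_smul, FracControl.Lp_ofReal_smul]
      exact hU_convex hu hv ha hb hab)
    hU_closed hScont hSadd yd hν
  have hcost : FracControl.cost As ω₀ α T R yd ν =
      fun u : FracControl.ControlSpace Z T => 1 / 2 * ‖S u - yd‖ ^ 2 + ν / 2 * ‖u‖ ^ 2 := by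
    funext u
    rw [FracControl.cost, hstate]
  refine ⟨fun u hu t ht => ?_, u, hu, hcost ▸ hmin, hcost ▸ huniq,
    FracControl.state As ω₀ α R u,
    FracControl.adjointState ι As ω₀ α T θ₀ (FracControl.state As ω₀ α R u T - yd),
    fun _ _ => rfl, fun _ _ => rfl, fun v hv => ?_⟩
  · rw [intervalIntegrable_iff_integrableOn_Ioo_of_le ht.1]
    have hle : volume.restrict (Ioo 0 t) ≤ μ :=
      Measure.restrict_mono (Ioo_subset_Ioo_right ht.2) le_rfl
    exact FracControl.integrable_clm_apply (k := FracControl.stateKernel As ω₀ α R t)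
      (hA.integrableOn_stateKernel hα_pos hα_le hθ₀ R ht.1)
      ((Lp.aestronglyMeasurable u).mono_measure hle) (ae_mono hle (hN u hu))
  · set q : Y := FracControl.state As ω₀ α R u T - yd with hq
    have hq' : q = S u - yd := by rw [hq, hstate]
    have hp : ∀ᵐ t ∂μ, ∀ z, inner ℂ z (FracControl.rStar R
        (FracControl.adjointState ι As ω₀ α T θ₀ q t)) = inner ℂ (k t z) q := by
      filter_upwards [ae_restrict_mem measurableSet_Ioo] with t ht z
      exact hA.inner_rStar_adjointState hι_inj hα_pos hα_le R ht.2 q z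
    obtain ⟨h1, h2⟩ :=
      FracControl.integrable_and_integral_inner_adjoint hp (hint u hu) (hint v hv) (ν : ℂ)
    refine ⟨h1, ?_⟩
    rw [h2, hq']
    exact hvar v hv
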